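/- Let $R$ be a commutative Noetherian ring of positive characteristic, let $(r_{ij})$ be an $m\times n$-matrix with entries in $R$, and let $\mathfrak a\subseteq R$ be the ideal generated by the $\min\{m,n\}$-minors of $(r_{ij})$. Let $\operatorname{ht}(\mathfrak a)$ denote the height of $\mathfrak a$, and let $\operatorname{cd}(R,\mathfrak a)$ denote its cohomological dimension, that is, the least natural number $c$ such that the local cohomology modules $H^i_{\mathfrak a}(M)$ vanish for all $R$-modules $M$ and all $i>c$. If $\operatorname{ht}(\mathfrak a)=|n-m|+1$, then $\operatorname{cd}(R,\mathfrak a)=\operatorname{ht}(\mathfrak a)$. -/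

import Mathlib

universe u

/-- The ideal generated by the `t`-minors of an `m × n` matrix, i.e. by the determinants of all its
`t × t` submatrices (rows and columns chosen in increasing order; the `0`-minor is `1`). -/
def Matrix.minorsIdeal {R : Type u} [CommRing R] {m n : ℕ} (A : Matrix (Fin m) (Fin n) R)
    (t : ℕ) : Ideal R :=
  Ideal.span {x : R | ∃ (f : Fin t ↪o Fin m) (g : Fin t ↪o Fin n), x = (A.submatrix f g).det}

/-- The cohomological dimension `cd(R, a)`: the least natural number `c` such that the local
cohomology modules `H_a^i(M)` vanish for all `R`-modules `M` and all `i > c`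
(and `⊤` if there is no such `c`). -/
noncomputable def Ideal.cohomologicalDimension {R : Type u} [CommRing R] (a : Ideal R) : ℕ∞ :=
  ⨅ (c : ℕ) (_ : ∀ (M : ModuleCat.{u} R) (i : ℕ), c < i →
    CategoryTheory.Limits.IsZero ((localCohomology a i).obj M)), (c : ℕ∞)

/-! Two inequalities valid in wider generality meet: the cohomological dimension is at most `|n - m|
+ 1` for any matrix over a Noetherian ring of positive characteristic, and at least the height for
any proper ideal of a Noetherian ring. The height hypothesis makes the bounds coincide and the ideal
proper.

The upper bound is the Peskine–Szpiro argument. Transposing if necessary, let `m ≤ n`. In prime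
characteristic `p`, the Frobenius power `I^[p^e]` of the ideal of maximal minors of a generic matrix
is the ideal of maximal minors of the matrix of `p^e`-th powers of the variables. The quotient by it
has projective dimension at most `n - m + 1`, uniformly in `e`
(`hasProjectiveDimensionLT_powMatrix`). Frobenius powers are cofinal with ordinary powers, so local
cohomology vanishes above that degree (`localCohomologyVanishes_of_frobenius`). Specialising the
variables to the entries of `A` is a surjection onto `R`, and local cohomology does not depend on
the base ring. A composite characteristic is handled by filtering the module, one prime factor at a
time.

The projective dimension comes from an induction on columns. If `J₁` is the annihilator of the
cokernel, `I` the one after deleting the last column, and `J₂` the one after deleting the last row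
as well, then `J₁ / I ≃ J₂ / I` through `lastRel`. This rests on certain linear forms acting
injectively from degree one to degree two of the symmetric algebra of the cokernel (`ColRegular`).
The same relation identifies the annihilator with the ideal of maximal minors
(`cokerAnn_powMatrix`).

For the lower bound, localising at a minimal prime of the ideal reduces to `dim R ≤ cd(R, 𝔪)` for
`R` local (`ringKrullDim_le_of_vanishes`), by induction on the cohomological dimension. The top
module `H^{c+1}_𝔪(R)` is Artinian and equals `𝔪` times itself, so some `x ∈ 𝔪` acts surjectively on
it; passing to `R / x` lowers the cohomological dimension, while the dimension drops by at most one.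
-/

open CategoryTheory Limits Abelian

noncomputable section

/-! ### Comparing derived-functor `Ext` with `Abelian.Ext` -/

section ExtComparison
variable {R : Type u} [CommRing R]

/-- Precomposition of cochains by a chain map. -/
def ChainComplex.linearYonedaMap {P P' : ChainComplex (ModuleCat.{u} R) ℕ} (φ : P' ⟶ P)
    (M : ModuleCat.{u} R) : P.linearYonedaObj R M ⟶ P'.linearYonedaObj R M :=
  (HomologicalComplex.unopFunctor _ _).map
    (((((linearYoneda R (ModuleCat.{u} R)).obj M).rightOp.mapHomologicalComplex _).map φ).op)

/-- `isoExt` is a composite of two isomorphisms, and for the second one naturality is available for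
the inverse; this glues the two squares. -/
theorem comp_eq_of_squares {C : Type*} [Category C] {A A' B B' D D' : C} {E : A ⟶ A'} {a' : A' ⟶ B'}
    {u' : D' ⟶ B'} {v' : B' ⟶ D'} {a : A ⟶ B} {u : D ⟶ B} {v : B ⟶ D} {h : D ⟶ D'} {c : B ⟶ B'}
    (h1 : E ≫ a' = a ≫ c) (h2 : u ≫ c = h ≫ u') (huv' : u' ≫ v' = 𝟙 _) (huv : v ≫ u = 𝟙 _) :
    E ≫ (a' ≫ v') = (a ≫ v) ≫ h := by
  have : c = v ≫ h ≫ u' := by rw [← h2, ← Category.assoc, huv, Category.id_comp]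
  rw [← Category.assoc, h1, this]
  simp [huv']

theorem isoExt_naturality {X X' : ModuleCat.{u} R} (g : X' ⟶ X) (P : ProjectiveResolution X)
    (P' : ProjectiveResolution X') (φ : ProjectiveResolution.Hom P' P g) (n : ℕ)
    (M : ModuleCat.{u} R) :
    ((Ext R (ModuleCat.{u} R) n).map g.op).app M ≫ (P'.isoExt (R := R) n M).hom =
      (P.isoExt n M).hom ≫
        HomologicalComplex.homologyMap (ChainComplex.linearYonedaMap φ.hom M) n := by
  have h1 := ProjectiveResolution.isoLeftDerivedObj_inv_naturality g P' P φ.hom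
    (by simpa using φ.hom_f_zero_comp_π_f_zero) ((linearYoneda R (ModuleCat.{u} R)).obj M).rightOp n
  have h2 := HomologicalComplex.homologyOp_hom_naturality (ChainComplex.linearYonedaMap φ.hom M) n
  exact comp_eq_of_squares (congrArg Quiver.Hom.unop h1) (congrArg Quiver.Hom.unop h2)
    (HomologicalComplex.homologyUnop _ n).hom_inv_id
    (HomologicalComplex.homologyUnop _ n).inv_hom_id

section Homology

variable (K : CochainComplex (ModuleCat.{u} R) ℕ)

theorem CochainComplex.exists_cycles (n : ℕ) (x : K.X n) (hx : K.d n (n + 1) x = 0) :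
    ∃ z : K.cycles n, K.iCycles n z = x :=
  ⟨HomologicalComplex.cyclesMk K x (n + 1) (by simp) hx, HomologicalComplex.i_cyclesMk K x _ _ _⟩

theorem CochainComplex.homologyπ_surjective (n : ℕ) : Function.Surjective (K.homologyπ n) :=
  (ModuleCat.epi_iff_surjective _).1 inferInstance

theorem CochainComplex.homologyπ_eq_zero_iff (n : ℕ) (z : K.cycles (n + 1)) :
    K.homologyπ (n + 1) z = 0 ↔ ∃ y : K.X n, K.d n (n + 1) y = K.iCycles (n + 1) z := by
  have hmono : Function.Injective (K.iCycles (n + 1)) :=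
    (ModuleCat.mono_iff_injective _).1 inferInstance
  constructor
  · intro h
    have hex : (ShortComplex.mk _ _ (K.toCycles_comp_homologyπ n (n + 1))).Exact :=
      ShortComplex.exact_of_g_is_cokernel _ (K.homologyIsCokernel n (n + 1) (by simp))
    obtain ⟨y, hy⟩ := (ShortComplex.moduleCat_exact_iff _).1 hex z h
    refine ⟨y, ?_⟩
    rw [← hy, ← K.toCycles_i n (n + 1)]
    rfl
  · rintro ⟨y, hy⟩
    have : z = K.toCycles n (n + 1) y := by
      apply hmono
      rw [← hy, ← K.toCycles_i n (n + 1)]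
      rfl
    rw [this]
    exact ConcreteCategory.congr_hom (K.toCycles_comp_homologyπ n (n + 1)) y

end Homology

/-- The vanishing of the pullback of a class in `Ext` computed on a projective resolution. -/
theorem ext_map_eq_zero_iff {X X' : ModuleCat.{u} R} (g : X' ⟶ X) (P : ProjectiveResolution X)
    (P' : ProjectiveResolution X') (φ : ProjectiveResolution.Hom P' P g) (n : ℕ)
    (M : ModuleCat.{u} R) (f : P.complex.X (n + 1) ⟶ M)
    (z : (P.complex.linearYonedaObj R M).cycles (n + 1))
    (hz : (P.complex.linearYonedaObj R M).iCycles (n + 1) z = f) :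
    ((Ext R (ModuleCat.{u} R) (n + 1)).map g.op).app M ((P.isoExt (R := R) (n + 1) M).inv
      ((P.complex.linearYonedaObj R M).homologyπ (n + 1) z)) = 0 ↔
    ∃ k : P'.complex.X n ⟶ M, P'.complex.d (n + 1) n ≫ k = φ.hom.f (n + 1) ≫ f := by
  have hinj : Function.Injective (P'.isoExt (R := R) (n + 1) M).hom :=
    (ModuleCat.mono_iff_injective _).1 inferInstance
  rw [← map_eq_zero_iff (P'.isoExt (R := R) (n + 1) M).hom.hom hinj]
  have e1 := ConcreteCategory.congr_hom (isoExt_naturality g P P' φ (n + 1) M)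
    ((P.isoExt (R := R) (n + 1) M).inv ((P.complex.linearYonedaObj R M).homologyπ (n + 1) z))
  have e2 := ConcreteCategory.congr_hom (P.isoExt (R := R) (n + 1) M).inv_hom_id
    ((P.complex.linearYonedaObj R M).homologyπ (n + 1) z)
  have e3 := ConcreteCategory.congr_hom (HomologicalComplex.homologyπ_naturality
    (ChainComplex.linearYonedaMap φ.hom M) (n + 1)) z
  have e4 := ConcreteCategory.congr_hom (HomologicalComplex.cyclesMap_i
    (ChainComplex.linearYonedaMap φ.hom M) (n + 1)) z
  have e5 : (P'.isoExt (R := R) (n + 1) M).hom.hom (((Ext R (ModuleCat.{u} R) (n + 1)).map g.op).app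
      M ((P.isoExt (R := R) (n + 1) M).inv ((P.complex.linearYonedaObj R M).homologyπ (n + 1) z))) =
      (P'.complex.linearYonedaObj R M).homologyπ (n + 1)
        (HomologicalComplex.cyclesMap (ChainComplex.linearYonedaMap φ.hom M) (n + 1) z) := by
    refine e1.trans (Eq.trans ?_ e3)
    exact congrArg (HomologicalComplex.homologyMap (ChainComplex.linearYonedaMap φ.hom M) (n + 1)) e2
  rw [e5, CochainComplex.homologyπ_eq_zero_iff]
  have e6 : (P'.complex.linearYonedaObj R M).iCycles (n + 1)
      (HomologicalComplex.cyclesMap (ChainComplex.linearYonedaMap φ.hom M) (n + 1) z) =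
      φ.hom.f (n + 1) ≫ f := by
    rw [← hz]
    exact e4
  rw [e6]
  rfl

theorem mk₀_comp_extMk_eq_zero_iff {X X' : ModuleCat.{u} R} (g : X' ⟶ X)
    (P : ProjectiveResolution X)
    (P' : ProjectiveResolution X') (φ : ProjectiveResolution.Hom P' P g) (n : ℕ)
    (M : ModuleCat.{u} R) (f : P.complex.X (n + 1) ⟶ M)
    (hf : P.complex.d (n + 2) (n + 1) ≫ f = 0) :
    (Ext.mk₀ g).comp (P.extMk f (n + 2) rfl hf) (zero_add _) = 0 ↔
    ∃ k : P'.complex.X n ⟶ M, P'.complex.d (n + 1) n ≫ k = φ.hom.f (n + 1) ≫ f := by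
  rw [ProjectiveResolution.mk₀_comp_extMk f _ _ hf φ,
    ProjectiveResolution.extMk_eq_zero_iff _ _ _ _ _ n rfl]

theorem nonempty_projectiveResolution_hom {X X' : ModuleCat.{u} R} (g : X' ⟶ X)
    (P : ProjectiveResolution X) (P' : ProjectiveResolution X') :
    Nonempty (ProjectiveResolution.Hom P' P g) :=
  ⟨⟨ProjectiveResolution.lift g P' P, ProjectiveResolution.lift_commutes_zero g P' P⟩⟩

/-- Both classes come from one cocycle on a projective resolution, and either pullback vanishes
exactly when the pulled-back cocycle is a coboundary. Matching vanishing is all that a filtered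
colimit needs, so no isomorphism of the two theories is constructed. -/
theorem exists_ext_of_abelianExt {X M : ModuleCat.{u} R} {n : ℕ} (x : Abelian.Ext X M (n + 1)) :
    ∃ y : ((Ext R (ModuleCat.{u} R) (n + 1)).obj (Opposite.op X)).obj M,
      ∀ {X' : ModuleCat.{u} R} (g : X' ⟶ X),
        ((Ext R (ModuleCat.{u} R) (n + 1)).map g.op).app M y = 0 ↔
          (Ext.mk₀ g).comp x (zero_add _) = 0 := by
  let P := projectiveResolution X
  obtain ⟨f, hf, rfl⟩ := P.extMk_surjective x (n + 2) rfl
  obtain ⟨z, hz⟩ := CochainComplex.exists_cycles (P.complex.linearYonedaObj R M) (n + 1) f hf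
  refine ⟨(P.isoExt (R := R) (n + 1) M).inv
      ((P.complex.linearYonedaObj R M).homologyπ (n + 1) z), fun g => ?_⟩
  obtain ⟨φ⟩ := nonempty_projectiveResolution_hom g P (projectiveResolution _)
  rw [mk₀_comp_extMk_eq_zero_iff g P _ φ]
  exact ext_map_eq_zero_iff g P _ φ n M f z hz

theorem exists_abelianExt_of_ext {X M : ModuleCat.{u} R} {n : ℕ}
    (y : ((Ext R (ModuleCat.{u} R) (n + 1)).obj (Opposite.op X)).obj M) :
    ∃ x : Abelian.Ext X M (n + 1),
      ∀ {X' : ModuleCat.{u} R} (g : X' ⟶ X),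
        ((Ext R (ModuleCat.{u} R) (n + 1)).map g.op).app M y = 0 ↔
          (Ext.mk₀ g).comp x (zero_add _) = 0 := by
  let P := projectiveResolution X
  obtain ⟨z, hz⟩ := CochainComplex.homologyπ_surjective _ _ ((P.isoExt (R := R) (n + 1) M).hom y)
  have hy : y = (P.isoExt (R := R) (n + 1) M).inv
      ((P.complex.linearYonedaObj R M).homologyπ (n + 1) z) := by
    rw [hz]
    exact (ConcreteCategory.congr_hom (P.isoExt (R := R) (n + 1) M).hom_inv_id y).symm
  have hf : P.complex.d (n + 2) (n + 1) ≫
      (show P.complex.X (n + 1) ⟶ M from (P.complex.linearYonedaObj R M).iCycles (n + 1) z) = 0 :=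
    ConcreteCategory.congr_hom ((P.complex.linearYonedaObj R M).iCycles_d (n + 1) (n + 2)) z
  refine ⟨P.extMk _ (n + 2) rfl hf, fun g => ?_⟩
  obtain ⟨φ⟩ := nonempty_projectiveResolution_hom g P (projectiveResolution _)
  rw [mk₀_comp_extMk_eq_zero_iff g P _ φ, hy]
  exact ext_map_eq_zero_iff g P _ φ n M _ z rfl

end ExtComparison

/-! ### Elementary form of the vanishing of local cohomology -/

section Vanishing

variable {R : Type u} [CommRing R]

/-- The projection `R ⧸ I ⟶ R ⧸ J` for `I ≤ J`. -/
def quotientProj {I J : Ideal R} (h : I ≤ J) :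
    ModuleCat.of R (R ⧸ I) ⟶ ModuleCat.of R (R ⧸ J) :=
  ModuleCat.ofHom (Submodule.mapQ I J LinearMap.id h)

theorem quotientProj_comp {I J K : Ideal R} (h : I ≤ J) (h' : J ≤ K) :
    quotientProj h ≫ quotientProj h' = quotientProj (h.trans h') := by
  ext
  rfl

/-- Every class in `Ext^i(R/a^t, M)` dies in some `Ext^i(R/a^s, M)`: the elementary form of the
vanishing of the `i`-th local cohomology. -/
def LocalCohomologyVanishes (a : Ideal R) (i : ℕ) (M : ModuleCat.{u} R) : Prop :=
  ∀ (t : ℕ) (x : Abelian.Ext (ModuleCat.of R (R ⧸ a ^ t)) M i), ∃ (s : ℕ) (h : t ≤ s),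
    (Ext.mk₀ (quotientProj (Ideal.pow_le_pow_right h))).comp x (zero_add i) = 0

/-- A filtered colimit of modules is zero iff every element of every stage dies at a later stage. -/
theorem isZero_localCohomology_iff (a : Ideal R) (i : ℕ) (M : ModuleCat.{u} R) :
    IsZero ((localCohomology a (i + 1)).obj M) ↔ LocalCohomologyVanishes a (i + 1) M := by
  let D := localCohomology.diagram (localCohomology.idealPowersDiagram a) (i + 1)
  have hc : IsColimit (((evaluation _ _).obj M).mapCocone (colimit.cocone D)) :=
    isColimitOfPreserves _ (colimit.isColimit D)
  have : PreservesFilteredColimitsOfSize.{0, 0} (forget (ModuleCat.{u} R)) :=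
    preservesFilteredColimitsOfSize_shrink.{0, u, 0, u} _
  have : PreservesColimit (D ⋙ (evaluation _ _).obj M) (forget (ModuleCat.{u} R)) := inferInstance
  have hz : IsZero ((localCohomology a (i + 1)).obj M) ↔
      Subsingleton (((evaluation _ _).obj M).mapCocone (colimit.cocone D)).pt := 
    ⟨fun h => ModuleCat.subsingleton_of_isZero h,
      fun h => @ModuleCat.isZero_of_subsingleton _ _ _ h⟩
  rw [hz]
  constructor
  · intro h t x
    obtain ⟨y, hy⟩ := exists_ext_of_abelianExt x
    obtain ⟨k, f, g, hfg⟩ := Concrete.isColimit_exists_of_rep_eq _ hc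
      (i := Opposite.op (Opposite.op t)) (j := Opposite.op (Opposite.op t)) y 0 (h.elim _ _)
    refine ⟨k.unop.unop, f.unop.unop.le, (hy _).1 ?_⟩
    exact hfg.trans (map_zero _)
  · intro h
    refine subsingleton_of_forall_eq 0 fun z => ?_
    obtain ⟨j, y, rfl⟩ := Concrete.isColimit_exists_rep _ hc z
    obtain ⟨x, hx⟩ := exists_abelianExt_of_ext y
    obtain ⟨s, hs, hs0⟩ := h _ x
    have h0 := (hx _).2 hs0
    let f : j ⟶ Opposite.op (Opposite.op s) := (homOfLE hs).op.op
    exact (Concrete.isColimit_rep_eq_of_exists (D := ((evaluation _ _).obj M).mapCocone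
      (colimit.cocone D)) _ (i := j) (j := j) y 0
      ⟨_, f, f, h0.trans (map_zero _).symm⟩).trans (map_zero _)

end Vanishing

/-! ### Torsion submodules and maps out of cyclic quotients -/

section Torsion

variable {R : Type u} [CommRing R]

/-- The submodule of elements killed by some power of `a`. -/
def Ideal.gammaTorsion (a : Ideal R) (M : Type*) [AddCommGroup M] [Module R M] :
    Submodule R M where
  carrier := {x | ∃ t : ℕ, ∀ r ∈ a ^ t, r • x = 0}
  zero_mem' := ⟨0, fun r _ => smul_zero r⟩
  add_mem' := by
    rintro x y ⟨t, ht⟩ ⟨s, hs⟩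
    refine ⟨t + s, fun r hr => ?_⟩
    rw [smul_add, ht r (Ideal.pow_le_pow_right (Nat.le_add_right t s) hr),
      hs r (Ideal.pow_le_pow_right (Nat.le_add_left s t) hr), add_zero]
  smul_mem' := by
    rintro c x ⟨t, ht⟩
    exact ⟨t, fun r hr => by rw [smul_comm, ht r hr, smul_zero]⟩

/-- The map `R ⧸ K ⟶ M` sending `1` to an element killed by `K`. -/
def quotientToModule {K : Ideal R} {M : ModuleCat.{u} R} (x : M) (h : ∀ r ∈ K, r • x = 0) :
    ModuleCat.of R (R ⧸ K) ⟶ M :=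
  ModuleCat.ofHom (Submodule.liftQ K (LinearMap.toSpanSingleton R M x) (fun r hr => h r hr))

theorem quotientToModule_one {K : Ideal R} {M : ModuleCat.{u} R} (x : M)
    (h : ∀ r ∈ K, r • x = 0) :
    (quotientToModule x h).hom (Submodule.Quotient.mk 1) = x :=
  one_smul R x

theorem quotient_hom_ext {K : Ideal R} {M : ModuleCat.{u} R}
    {f g : ModuleCat.of R (R ⧸ K) ⟶ M}
    (h : f.hom (Submodule.Quotient.mk 1) = g.hom (Submodule.Quotient.mk 1)) : f = g := by
  ext : 1
  refine Submodule.linearMap_qext K (LinearMap.ext_ring ?_)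
  exact h

theorem smul_quotient_hom_one {K : Ideal R} {M : ModuleCat.{u} R}
    (f : ModuleCat.of R (R ⧸ K) ⟶ M) (r : R) (hr : r ∈ K) :
    r • f.hom (Submodule.Quotient.mk 1) = 0 := by
  rw [← map_smul, ← Submodule.Quotient.mk_smul]
  have : (Submodule.Quotient.mk (r • (1 : R)) : R ⧸ K) = 0 :=
    (Submodule.Quotient.mk_eq_zero K).2 (by simpa using hr)
  rw [this, map_zero]

end Torsion

/-! ### Long exact sequence arguments for vanishing -/

namespace LocalCohomologyVanishes

variable {R : Type u} [CommRing R] {a b : Ideal R} {i : ℕ} {M N : ModuleCat.{u} R}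

theorem exists_pullback_eq_zero (h : LocalCohomologyVanishes a i M) {K : Ideal R} {t : ℕ}
    (hK : a ^ t ≤ K) (x : Abelian.Ext (ModuleCat.of R (R ⧸ K)) M i) :
    ∃ (s : ℕ) (_ : t ≤ s) (hs : a ^ s ≤ K),
      (Ext.mk₀ (quotientProj hs)).comp x (zero_add i) = 0 := by
  obtain ⟨s, hs, h0⟩ := h t ((Ext.mk₀ (quotientProj hK)).comp x (zero_add i))
  refine ⟨s, hs, (Ideal.pow_le_pow_right hs).trans hK, ?_⟩
  rw [← quotientProj_comp (Ideal.pow_le_pow_right hs) hK, ← Ext.mk₀_comp_mk₀_assoc]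
  exact h0

/-- Local cohomology depends only on the topology defined by the ideal. -/
theorem of_cofinal (h : LocalCohomologyVanishes a i M) (hab : ∀ t, ∃ s, a ^ s ≤ b ^ t)
    (hba : ∀ t, ∃ s, b ^ s ≤ a ^ t) : LocalCohomologyVanishes b i M := by
  intro t x
  obtain ⟨s, hs⟩ := hab t
  obtain ⟨s', _, hs'K, h0⟩ := h.exists_pullback_eq_zero hs x
  obtain ⟨t', ht'⟩ := hba s'
  refine ⟨max t t', le_max_left _ _, ?_⟩
  have h1 : b ^ max t t' ≤ a ^ s' := (Ideal.pow_le_pow_right (le_max_right _ _)).trans ht'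
  rw [← quotientProj_comp h1 hs'K, ← Ext.mk₀_comp_mk₀_assoc, h0, Ext.comp_zero]

theorem of_iso (e : M ≅ N) (h : LocalCohomologyVanishes a i M) : LocalCohomologyVanishes a i N := by
  intro t x
  obtain ⟨s, hs, h0⟩ := h t (x.comp (Ext.mk₀ e.inv) (add_zero i))
  refine ⟨s, hs, ?_⟩
  have := congrArg (fun y => Ext.comp y (Ext.mk₀ e.hom) (add_zero i)) h0
  simpa using this

theorem of_injective (a : Ideal R) (i : ℕ) (M : ModuleCat.{u} R) [Injective M] :
    LocalCohomologyVanishes a (i + 1) M :=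
  fun t x => ⟨t, le_rfl, by rw [Ext.eq_zero_of_injective x, Ext.comp_zero]⟩

variable {S : ShortComplex (ModuleCat.{u} R)} (hS : S.ShortExact)
include hS

/-- As in the two lemmas that follow, one exact spot of the long exact `Ext` sequence is chased:
enlarge the power to kill the image of the class, lift by exactness, and enlarge it again to kill
the lift. -/
theorem X₂ (h₁ : LocalCohomologyVanishes a i S.X₁) (h₃ : LocalCohomologyVanishes a i S.X₃) :
    LocalCohomologyVanishes a i S.X₂ := by
  intro t x
  obtain ⟨s, hs, h0⟩ := h₃ t (x.comp (Ext.mk₀ S.g) (add_zero i))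
  rw [← Ext.comp_assoc_of_third_deg_zero] at h0
  obtain ⟨y, hy⟩ := Ext.covariant_sequence_exact₂ _ hS _ h0
  obtain ⟨s', hs', h0'⟩ := h₁ s y
  refine ⟨s', hs.trans hs', ?_⟩
  rw [← quotientProj_comp (Ideal.pow_le_pow_right hs') (Ideal.pow_le_pow_right hs),
    ← Ext.mk₀_comp_mk₀_assoc, ← hy, ← Ext.comp_assoc_of_third_deg_zero, h0', Ext.zero_comp]

theorem X₁ (h₂ : LocalCohomologyVanishes a (i + 1) S.X₂) (h₃ : LocalCohomologyVanishes a i S.X₃) :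
    LocalCohomologyVanishes a (i + 1) S.X₁ := by
  intro t x
  obtain ⟨s, hs, h0⟩ := h₂ t (x.comp (Ext.mk₀ S.f) (add_zero (i + 1)))
  rw [← Ext.comp_assoc_of_third_deg_zero] at h0
  obtain ⟨y, hy⟩ := Ext.covariant_sequence_exact₁ _ hS _ h0 rfl
  obtain ⟨s', hs', h0'⟩ := h₃ s y
  refine ⟨s', hs.trans hs', ?_⟩
  rw [← quotientProj_comp (Ideal.pow_le_pow_right hs') (Ideal.pow_le_pow_right hs),
    ← Ext.mk₀_comp_mk₀_assoc, ← hy, ← Ext.comp_assoc _ _ _ (zero_add i) rfl (by lia), h0',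
    Ext.zero_comp]

theorem X₃ (h₁ : LocalCohomologyVanishes a (i + 1) S.X₁) (h₂ : LocalCohomologyVanishes a i S.X₂) :
    LocalCohomologyVanishes a i S.X₃ := by
  intro t x
  obtain ⟨s, hs, h0⟩ := h₁ t (x.comp hS.extClass rfl)
  rw [← Ext.comp_assoc _ _ _ (zero_add i) rfl (by lia)] at h0
  obtain ⟨y, hy⟩ := Ext.covariant_sequence_exact₃ _ hS _ rfl h0
  obtain ⟨s', hs', h0'⟩ := h₂ s y
  refine ⟨s', hs.trans hs', ?_⟩
  rw [← quotientProj_comp (Ideal.pow_le_pow_right hs') (Ideal.pow_le_pow_right hs),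
    ← Ext.mk₀_comp_mk₀_assoc, ← hy, ← Ext.comp_assoc_of_third_deg_zero, h0', Ext.zero_comp]

/-- A torsion element is a map `R / a^t ⟶ S.X₃`; once its connecting class dies over `R / a^s`, that
map lifts to `S.X₂`. With `of_torsion_lift`, this expresses the degree-zero end of the sequence
through torsion elements. -/
theorem exists_torsion_lift (h₁ : LocalCohomologyVanishes a 1 S.X₁) (y : S.X₃)
    (hy : y ∈ a.gammaTorsion S.X₃) : ∃ x ∈ a.gammaTorsion S.X₂, S.g x = y := by
  obtain ⟨t, ht⟩ := hy
  obtain ⟨s, hs, h0⟩ := h₁ t ((Ext.mk₀ (quotientToModule y ht)).comp hS.extClass (zero_add 1))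
  rw [Ext.mk₀_comp_mk₀_assoc] at h0
  obtain ⟨z, hz⟩ := Ext.covariant_sequence_exact₃ _ hS _ _ h0
  obtain ⟨f, rfl⟩ := Ext.addEquiv₀.symm.surjective z
  change (Ext.mk₀ f).comp (Ext.mk₀ S.g) _ = _ at hz
  rw [Ext.mk₀_comp_mk₀] at hz
  have hfg := (Ext.mk₀_bijective _ _).1 hz
  refine ⟨f.hom (Submodule.Quotient.mk 1), ⟨s, smul_quotient_hom_one f⟩, ?_⟩
  have := ConcreteCategory.congr_hom hfg (Submodule.Quotient.mk 1)
  exact this.trans (quotientToModule_one y ht)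

theorem of_torsion_lift (h₂ : LocalCohomologyVanishes a 1 S.X₂)
    (h : ∀ y ∈ a.gammaTorsion S.X₃, ∃ x ∈ a.gammaTorsion S.X₂, S.g x = y) :
    LocalCohomologyVanishes a 1 S.X₁ := by
  intro t x
  obtain ⟨s, hs, h0⟩ := h₂ t (x.comp (Ext.mk₀ S.f) (add_zero 1))
  rw [← Ext.comp_assoc_of_third_deg_zero] at h0
  obtain ⟨y, hy⟩ := Ext.covariant_sequence_exact₁ _ hS _ h0 rfl
  obtain ⟨f, rfl⟩ := Ext.addEquiv₀.symm.surjective y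
  change (Ext.mk₀ f).comp _ _ = _ at hy
  obtain ⟨z, ⟨s', hz⟩, hzf⟩ := h (f.hom (Submodule.Quotient.mk 1)) ⟨s, smul_quotient_hom_one f⟩
  have hz' : ∀ r ∈ a ^ max s s', r • z = 0 := fun r hr =>
    hz r (Ideal.pow_le_pow_right (le_max_right _ _) hr)
  have hle : a ^ max s s' ≤ a ^ s := Ideal.pow_le_pow_right (le_max_left _ _)
  have key : quotientProj hle ≫ f = quotientToModule z hz' ≫ S.g := by
    apply quotient_hom_ext
    change f.hom (Submodule.Quotient.mk 1) = S.g ((quotientToModule z hz').hom _)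
    rw [quotientToModule_one, hzf]
  refine ⟨max s s', hs.trans (le_max_left _ _), ?_⟩
  rw [← quotientProj_comp hle (Ideal.pow_le_pow_right hs),
    ← Ext.mk₀_comp_mk₀_assoc, ← hy, Ext.mk₀_comp_mk₀_assoc, key, ← Ext.mk₀_comp_mk₀_assoc,
    hS.comp_extClass, Ext.comp_zero]

end LocalCohomologyVanishes

/-! ### Torsion of injectives, and acyclicity of torsion modules -/

section InjectiveTorsion

variable {R : Type u} [CommRing R]

theorem Ideal.exists_pow_smul_eq_zero_of_fg (a : Ideal R) {M W : Type*} [AddCommGroup M]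
    [Module R M]
    [AddCommGroup W] [Module R W] [Module.Finite R W] (f : W →ₗ[R] M)
    (hf : ∀ w, f w ∈ a.gammaTorsion M) : ∃ t : ℕ, ∀ r ∈ a ^ t, ∀ w, r • f w = 0 := by
  obtain ⟨s, hs⟩ := (Module.finite_def (R := R) (M := W)).1 inferInstance
  choose t ht using hf
  refine ⟨s.sup t, fun r hr w => ?_⟩
  have : w ∈ Submodule.span R (s : Set W) := hs ▸ Submodule.mem_top
  induction this using Submodule.span_induction with
  | mem x hx => exact ht x r (Ideal.pow_le_pow_right (Finset.le_sup hx) hr)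
  | zero => simp
  | add x y _ _ hx hy => rw [map_add, smul_add, hx, hy, add_zero]
  | smul c x _ hx => rw [map_smul, smul_comm, hx, smul_zero]

/-- Baer's criterion plus Artin–Rees: the image of `φ : b → Γ(E)` is killed by some `a ^ k`, so `φ`
vanishes on `b ∩ a ^ (c + k) ⊆ a ^ k • b`. It therefore extends to `R / a ^ (c + k) → E`, whose
image is again torsion. -/
theorem Ideal.injective_gammaTorsion [IsNoetherianRing R] (a : Ideal R) (E : Type u)
    [AddCommGroup E] [Module R E] [Module.Injective R E] :
    Module.Injective R (a.gammaTorsion E) := by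
  apply Module.Baer.injective
  intro b φ
  obtain ⟨k, hk⟩ := a.exists_pow_smul_eq_zero_of_fg ((a.gammaTorsion E).subtype ∘ₗ φ)
    (fun w => (φ w).2)
  obtain ⟨c, hc⟩ := a.exists_pow_inf_eq_pow_smul b
  have hn := hc (c + k) (Nat.le_add_right c k)
  rw [Nat.add_sub_cancel_left] at hn
  have hker : ∀ x : b, (x : R) ∈ a ^ (c + k) → φ x = 0 := by
    intro x hx
    have h1 : (x : R) ∈ a ^ k • b := by
      have : (x : R) ∈ a ^ (c + k) • ⊤ ⊓ b := ⟨by simpa using hx, x.2⟩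
      rw [hn] at this
      exact Submodule.smul_mono le_rfl inf_le_right this
    have h2 : a ^ k • b ≤ Submodule.map b.subtype (LinearMap.ker φ) := by
      refine Submodule.smul_le.2 fun r hr z hz => ⟨r • ⟨z, hz⟩, ?_, rfl⟩
      rw [SetLike.mem_coe, LinearMap.mem_ker, map_smul]
      exact Subtype.ext (hk r hr ⟨z, hz⟩)
    obtain ⟨y, hy, hyx⟩ := h2 h1
    rwa [Subtype.ext hyx] at hy
  let p : Submodule R b := Submodule.comap b.subtype (a ^ (c + k))
  obtain ⟨h, hh⟩ := Module.Injective.out (Q := E)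
    (Submodule.mapQ p (a ^ (c + k)) b.subtype le_rfl)
    (by
      rw [← LinearMap.ker_eq_bot, Submodule.mapQ, Submodule.ker_liftQ_eq_bot]
      intro x hx
      exact (Submodule.Quotient.mk_eq_zero (a ^ (c + k))).1 hx)
    (Submodule.liftQ p ((a.gammaTorsion E).subtype ∘ₗ φ) (fun x hx => by
      rw [LinearMap.mem_ker, LinearMap.comp_apply, hker x hx, map_zero]))
  refine ⟨LinearMap.codRestrict _ (h ∘ₗ Submodule.mkQ _) fun r => ⟨c + k, fun s hs => ?_⟩, ?_⟩
  · rw [← map_smul, LinearMap.comp_apply]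
    have : Submodule.mkQ (a ^ (c + k)) (s • r) = 0 := by
      rw [Submodule.mkQ_apply, Submodule.Quotient.mk_eq_zero]
      exact Ideal.mul_mem_right _ _ hs
    rw [this, map_zero]
  · intro x hx
    apply Subtype.ext
    exact hh (Submodule.Quotient.mk ⟨x, hx⟩)

theorem Ideal.gammaTorsion_eq_top_of_surjective {a : Ideal R} {M N : Type*} [AddCommGroup M]
    [Module R M] [AddCommGroup N] [Module R N] (f : M →ₗ[R] N) (hf : Function.Surjective f)
    (hM : a.gammaTorsion M = ⊤) : a.gammaTorsion N = ⊤ := by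
  refine eq_top_iff.2 fun y _ => ?_
  obtain ⟨x, rfl⟩ := hf y
  obtain ⟨t, ht⟩ : x ∈ a.gammaTorsion M := hM ▸ Submodule.mem_top
  exact ⟨t, fun r hr => by rw [← map_smul, ht r hr, map_zero]⟩

theorem Ideal.gammaTorsion_gammaTorsion (a : Ideal R) (M : Type*) [AddCommGroup M] [Module R M] :
    a.gammaTorsion (a.gammaTorsion M) = ⊤ := by
  refine eq_top_iff.2 fun y _ => ?_
  obtain ⟨t, ht⟩ := y.2
  exact ⟨t, fun r hr => Subtype.ext (ht r hr)⟩

/-- The short complex attached to an injective linear map and its cokernel. -/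
def cokernelShortComplex {M E : ModuleCat.{u} R} (f : M ⟶ E) : ShortComplex (ModuleCat.{u} R) :=
  ShortComplex.mk f (cokernel.π f) (cokernel.condition f)

theorem shortExact_cokernelShortComplex {M E : ModuleCat.{u} R} (f : M ⟶ E) [Mono f] :
    (cokernelShortComplex f).ShortExact where
  exact := ShortComplex.exact_cokernel f
  mono_f := inferInstanceAs (Mono f)
  epi_g := inferInstanceAs (Epi (cokernel.π f))

theorem exists_mono_injective_gammaTorsion [IsNoetherianRing R] (a : Ideal R)
    (M : ModuleCat.{u} R) (hM : a.gammaTorsion M = ⊤) :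
    ∃ (E : ModuleCat.{u} R) (j : M ⟶ E), Mono j ∧ Injective E ∧ a.gammaTorsion E = ⊤ := by
  let E₀ : ModuleCat.{u} R := Injective.under M
  have : Module.Injective R E₀ := Module.injective_module_of_injective_object R _
      (inj := inferInstanceAs (Injective (Injective.under M)))
  have := a.injective_gammaTorsion E₀
  have hj : ∀ x, (Injective.ι M).hom x ∈ a.gammaTorsion E₀ := fun x => by
    obtain ⟨t, ht⟩ : x ∈ a.gammaTorsion M := hM ▸ Submodule.mem_top
    exact ⟨t, fun r hr => by
      have := congrArg (Injective.ι M).hom (ht r hr)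
      rwa [map_smul, map_zero] at this⟩
  refine ⟨ModuleCat.of R (a.gammaTorsion E₀),
    ModuleCat.ofHom (LinearMap.codRestrict _ (Injective.ι M).hom hj), ?_,
    Module.injective_object_of_injective_module _ _, a.gammaTorsion_gammaTorsion E₀⟩
  rw [ModuleCat.mono_iff_injective]
  intro x y hxy
  exact (ModuleCat.mono_iff_injective (Injective.ι M)).1 inferInstance (congrArg Subtype.val hxy)

/-- Torsion modules are acyclic for local cohomology. -/
theorem LocalCohomologyVanishes.of_gammaTorsion_eq_top [IsNoetherianRing R] (a : Ideal R) (i : ℕ)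
    (M : ModuleCat.{u} R) (hM : a.gammaTorsion M = ⊤) : LocalCohomologyVanishes a (i + 1) M := by
  induction i generalizing M with
  | zero =>
    -- The injective envelope can be taken torsion, so every torsion element of the cokernel lifts
    -- to a torsion element for free.
    obtain ⟨E, j, _, _, hE⟩ := exists_mono_injective_gammaTorsion a M hM
    have hS := shortExact_cokernelShortComplex j
    refine LocalCohomologyVanishes.of_torsion_lift hS (of_injective a 0 E) fun y _ => ?_
    obtain ⟨x, hx⟩ := hS.moduleCat_surjective_g y
    exact ⟨x, by change x ∈ a.gammaTorsion E; rw [hE]; trivial, hx⟩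
  | succ i ih =>
    obtain ⟨E, j, _, _, hE⟩ := exists_mono_injective_gammaTorsion a M hM
    have hS := shortExact_cokernelShortComplex j
    exact LocalCohomologyVanishes.X₁ hS (of_injective a (i + 1) E)
      (ih _ (Ideal.gammaTorsion_eq_top_of_surjective (cokernelShortComplex j).g.hom
        hS.moduleCat_surjective_g hE))

end InjectiveTorsion

/-! ### Acyclicity of `Hom(W, D)` for `W` finite and `D` injective -/

section HomAcyclic

variable {R : Type u} [CommRing R] {W W' D : Type u} [AddCommGroup W] [Module R W]
  [AddCommGroup W'] [Module R W'] [AddCommGroup D] [Module R D]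

/-- The short complex `Hom(W, D) ⟶ Hom(W', D) ⟶ Hom(ker f, D)` for `f : W' → W`. -/
def homShortComplex (D : Type u) [AddCommGroup D] [Module R D] (f : W' →ₗ[R] W) :
    ShortComplex (ModuleCat.{u} R) :=
  ShortComplex.mk (ModuleCat.ofHom (LinearMap.lcomp R D f))
    (ModuleCat.ofHom (LinearMap.lcomp R D (LinearMap.ker f).subtype)) (by
      ext φ x
      have : f x = 0 := x.2
      simp [this])

theorem shortExact_homShortComplex [Module.Injective R D] (f : W' →ₗ[R] W)
    (hf : Function.Surjective f) : (homShortComplex D f).ShortExact := by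
  refine ModuleCat.shortComplex_shortExact _ ?_ ?_ ?_
  · intro (φ : W' →ₗ[R] D)
    constructor
    · intro (h : φ ∘ₗ (LinearMap.ker f).subtype = 0)
      have hker : LinearMap.ker f ≤ LinearMap.ker φ := fun x hx =>
        LinearMap.congr_fun h ⟨x, hx⟩
      refine ⟨(Submodule.liftQ _ φ hker) ∘ₗ (f.quotKerEquivOfSurjective hf).symm.toLinearMap, ?_⟩
      apply LinearMap.ext
      intro x
      change Submodule.liftQ _ φ hker ((f.quotKerEquivOfSurjective hf).symm (f x)) = φ x
      have : (f.quotKerEquivOfSurjective hf).symm (f x) = Submodule.Quotient.mk x := by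
        rw [LinearEquiv.symm_apply_eq]
        rfl
      rw [this]
      rfl
    · rintro ⟨ψ : W →ₗ[R] D, rfl⟩
      apply LinearMap.ext
      intro x
      change ψ (f x) = 0
      rw [show f x = 0 from x.2, map_zero]
  · intro (φ : W →ₗ[R] D) (ψ : W →ₗ[R] D) h
    exact LinearMap.ext fun w => by
      obtain ⟨v, rfl⟩ := hf w
      exact LinearMap.congr_fun h v
  · intro (φ : LinearMap.ker f →ₗ[R] D)
    obtain ⟨h, hh⟩ := Module.Injective.out (LinearMap.ker f).subtype Subtype.val_injective φ
    exact ⟨h, LinearMap.ext hh⟩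

theorem injective_linearMap_fin [Module.Injective R D] (n : ℕ) :
    Module.Injective R ((Fin n → R) →ₗ[R] D) :=
  Module.Baer.injective (Module.Baer.of_equiv ((Pi.basisFun R (Fin n)).constr R)
    (Module.Baer.of_injective inferInstance))

/-- If `D` is injective and `W` finitely generated then `Hom(W, D)` is acyclic for local
cohomology. -/
theorem LocalCohomologyVanishes.linearMap [IsNoetherianRing R] (a : Ideal R) (i : ℕ)
    [Module.Finite R W] [Module.Injective R D] :
    LocalCohomologyVanishes a (i + 1) (ModuleCat.of R (W →ₗ[R] D)) := by
  induction i generalizing W with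
  | zero =>
    obtain ⟨n, f, hf⟩ := Module.Finite.exists_fin' R W
    have := injective_linearMap_fin (R := R) (D := D) n
    have hinj : Injective (ModuleCat.of R ((Fin n → R) →ₗ[R] D)) :=
      Module.injective_object_of_injective_module _ _
    refine LocalCohomologyVanishes.of_torsion_lift (shortExact_homShortComplex (D := D) f hf)
      (of_injective a 0 (ModuleCat.of R ((Fin n → R) →ₗ[R] D))) ?_
    rintro (φ : LinearMap.ker f →ₗ[R] D) ⟨t, ht⟩
    -- A torsion `φ` takes values in `Γ(D)`, itself injective. Extending inside `Γ(D)` yields a map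
    -- with finitely generated image, hence killed by a single power of `a`.
    have := a.injective_gammaTorsion D
    obtain ⟨h, hh⟩ := Module.Injective.out (LinearMap.ker f).subtype Subtype.val_injective
      (LinearMap.codRestrict (a.gammaTorsion D) φ fun x => ⟨t, fun r hr =>
        LinearMap.congr_fun (ht r hr) x⟩)
    obtain ⟨s, hs⟩ := a.exists_pow_smul_eq_zero_of_fg ((a.gammaTorsion D).subtype ∘ₗ h)
      (fun w => (h w).2)
    exact ⟨(a.gammaTorsion D).subtype ∘ₗ h, ⟨s, fun r hr => LinearMap.ext fun w => hs r hr w⟩,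
      LinearMap.ext fun x => congrArg Subtype.val (hh x)⟩
  | succ i ih =>
    obtain ⟨n, f, hf⟩ := Module.Finite.exists_fin' R W
    have := injective_linearMap_fin (R := R) (D := D) n
    have hinj : Injective (ModuleCat.of R ((Fin n → R) →ₗ[R] D)) :=
      Module.injective_object_of_injective_module _ _
    exact LocalCohomologyVanishes.X₁ (shortExact_homShortComplex (D := D) f hf)
      (of_injective a (i + 1) (ModuleCat.of R ((Fin n → R) →ₗ[R] D))) ih

end HomAcyclic

/-! ### Independence of the base ring -/

section BaseChange

variable {R T : Type u} [CommRing R] [CommRing T] (φ : R →+* T)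

theorem mem_gammaTorsion_restrictScalars_iff (a : Ideal R) (M : ModuleCat.{u} T) (x : M) :
    (show (ModuleCat.restrictScalars φ).obj M from x) ∈
      a.gammaTorsion ((ModuleCat.restrictScalars φ).obj M) ↔ x ∈ (a.map φ).gammaTorsion M := by
  constructor
  · rintro ⟨t, ht⟩
    refine ⟨t, fun r hr => ?_⟩
    rw [← Ideal.map_pow] at hr
    have hle : (a ^ t).map φ ≤ LinearMap.ker (LinearMap.toSpanSingleton T M x) :=
      Ideal.map_le_iff_le_comap.2 fun s hs => ht s hs
    exact hle hr
  · rintro ⟨t, ht⟩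
    exact ⟨t, fun r hr => ht (φ r) (by rw [← Ideal.map_pow]; exact Ideal.mem_map_of_mem φ hr)⟩

/-- Independence of the base ring, provided that there are enough modules which are acyclic for
both local cohomologies. -/
theorem localCohomologyVanishes_restrictScalars_iff_of_acyclic (a : Ideal R)
    (h : ∀ M : ModuleCat.{u} T, ∃ (E : ModuleCat.{u} T) (j : M ⟶ E), Mono j ∧
      ∀ i, LocalCohomologyVanishes (a.map φ) (i + 1) E ∧
        LocalCohomologyVanishes a (i + 1) ((ModuleCat.restrictScalars φ).obj E))
    (i : ℕ) (M : ModuleCat.{u} T) :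
    LocalCohomologyVanishes a (i + 1) ((ModuleCat.restrictScalars φ).obj M) ↔
      LocalCohomologyVanishes (a.map φ) (i + 1) M := by
  -- Dimension shifting along the acyclic embedding. In degree one the criterion is the lifting of
  -- torsion elements, which reads the same over both rings.
  induction i generalizing M with
  | zero =>
    obtain ⟨E, j, _, hE⟩ := h M
    have hS := shortExact_cokernelShortComplex j
    have hS' := hS.map_of_exact (ModuleCat.restrictScalars φ)
    constructor
    · intro hM
      refine LocalCohomologyVanishes.of_torsion_lift hS (hE 0).1 fun y hy => ?_
      obtain ⟨x, hx, hxy⟩ := LocalCohomologyVanishes.exists_torsion_lift hS' hM y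
        ((mem_gammaTorsion_restrictScalars_iff φ a _ y).2 hy)
      exact ⟨x, (mem_gammaTorsion_restrictScalars_iff φ a _ x).1 hx, hxy⟩
    · intro hM
      refine LocalCohomologyVanishes.of_torsion_lift hS' (hE 0).2 fun y hy => ?_
      obtain ⟨x, hx, hxy⟩ := LocalCohomologyVanishes.exists_torsion_lift hS hM y
        ((mem_gammaTorsion_restrictScalars_iff φ a _ y).1 hy)
      exact ⟨x, (mem_gammaTorsion_restrictScalars_iff φ a _ x).2 hx, hxy⟩
  | succ i ih =>
    obtain ⟨E, j, _, hE⟩ := h M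
    have hS := shortExact_cokernelShortComplex j
    have hS' := hS.map_of_exact (ModuleCat.restrictScalars φ)
    constructor
    · intro hM
      exact LocalCohomologyVanishes.X₁ hS (hE (i + 1)).1
        ((ih _).1 (LocalCohomologyVanishes.X₃ hS' hM (hE i).2))
    · intro hM
      exact LocalCohomologyVanishes.X₁ hS' (hE (i + 1)).2
        ((ih _).2 (LocalCohomologyVanishes.X₃ hS hM (hE i).1))

/-- Restriction of scalars is right adjoint to an exact functor, so it preserves injectives. -/
theorem localCohomologyVanishes_restrictScalars_iff_of_flat (hφ : φ.Flat) (a : Ideal R) (i : ℕ)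
    (M : ModuleCat.{u} T) :
    LocalCohomologyVanishes a (i + 1) ((ModuleCat.restrictScalars φ).obj M) ↔
      LocalCohomologyVanishes (a.map φ) (i + 1) M := by
  refine localCohomologyVanishes_restrictScalars_iff_of_acyclic φ a (fun M => ?_) i M
  have := ModuleCat.preservesFiniteLimits_extendScalars_of_flat hφ
  have := Injective.injective_of_adjoint (ModuleCat.extendRestrictScalarsAdj.{u} φ)
    (Injective.under M)
  exact ⟨Injective.under M, Injective.ι M, inferInstance, fun i =>
    ⟨LocalCohomologyVanishes.of_injective _ i _, LocalCohomologyVanishes.of_injective _ i _⟩⟩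

/-- The acyclic embedding is into `Hom_R(T, D)` with `D` injective over `R`: it is injective over
`T`, and acyclic over `R` because `T` is a finite `R`-module. -/
theorem localCohomologyVanishes_restrictScalars_iff_of_surjective [IsNoetherianRing R]
    (hφ : Function.Surjective φ) (a : Ideal R) (i : ℕ) (M : ModuleCat.{u} T) :
    LocalCohomologyVanishes a (i + 1) ((ModuleCat.restrictScalars φ).obj M) ↔
      LocalCohomologyVanishes (a.map φ) (i + 1) M := by
  refine localCohomologyVanishes_restrictScalars_iff_of_acyclic φ a (fun M => ?_) i M
  let adj := ModuleCat.restrictCoextendScalarsAdj.{u} φ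
  let D := Injective.under ((ModuleCat.restrictScalars φ).obj M)
  have hD : Module.Injective R D := Module.injective_module_of_injective_object R D
    (inj := inferInstanceAs (Injective (Injective.under ((ModuleCat.restrictScalars φ).obj M))))
  have hinj := Injective.injective_of_adjoint adj D
  let j : M ⟶ (ModuleCat.coextendScalars φ).obj D :=
    adj.homEquiv _ _ (Injective.ι ((ModuleCat.restrictScalars φ).obj M))
  have hj : (ModuleCat.restrictScalars φ).map j ≫ adj.counit.app D =
      Injective.ι ((ModuleCat.restrictScalars φ).obj M) := by
    exact (adj.homEquiv_counit M D j).symm.trans (Equiv.symm_apply_apply _ _)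
  -- Followed by the counit, the restriction of `j` is the embedding into `D`.
  have hmono : Mono j := by
    have : Mono ((ModuleCat.restrictScalars φ).map j ≫ adj.counit.app D) := hj ▸ inferInstance
    have := mono_of_mono ((ModuleCat.restrictScalars φ).map j) (adj.counit.app D)
    exact (ModuleCat.restrictScalars φ).mono_of_mono_map this
  refine ⟨_, j, hmono, fun i => ⟨LocalCohomologyVanishes.of_injective _ i _, ?_⟩⟩
  let W := (ModuleCat.restrictScalars φ).obj (ModuleCat.of T T)
  have : Module.Finite R W := by
    refine Module.Finite.of_surjective (LinearMap.toSpanSingleton R W (1 : T)) fun t => ?_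
    obtain ⟨r, rfl⟩ := hφ t
    exact ⟨r, mul_one (φ r)⟩
  refine LocalCohomologyVanishes.of_iso ?_
    (LocalCohomologyVanishes.linearMap (W := W) (D := D) a i)
  let e : (W →ₗ[R] D) ≃ₗ[R] (ModuleCat.restrictScalars φ).obj ((ModuleCat.coextendScalars φ).obj D) :=
    { toFun := fun f => f
      invFun := fun f => f
      map_add' := fun _ _ => rfl
      map_smul' := fun r f => LinearMap.ext fun (t : T) => by
        exact (f.map_smul r t).symm.trans
          (congrArg (fun s : T => f (show W from s)) (mul_comm (φ r) t))
      left_inv := fun _ => rfl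
      right_inv := fun _ => rfl }
  exact e.toModuleIso

end BaseChange

/-! ### Linear forms acting on the symmetric algebra of a cokernel -/

section SymProd

variable {T : Type u} [CommRing T] {m r : ℕ}

/-- The coefficients of the quadratic form which is the product of the linear forms with
coefficient vectors `g` and `h`. -/
def symProd (T : Type u) [CommRing T] (m : ℕ) :
    (Fin m → T) →ₗ[T] (Fin m → T) →ₗ[T] (Fin m → Fin m → T) :=
  -- The diagonal entry is the true coefficient of the square, not its double, so nothing is lost in
  -- characteristic two.
  LinearMap.mk₂ T (fun g h i l => if i = l then g i * h i else g i * h l + g l * h i)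
    (by intros; ext i l; by_cases h : i = l <;> simp [h] <;> ring)
    (by intros; ext i l; by_cases h : i = l <;> simp [h] <;> ring)
    (by intros; ext i l; by_cases h : i = l <;> simp [h] <;> ring)
    (by intros; ext i l; by_cases h : i = l <;> simp [h] <;> ring)

theorem symProd_apply (g h : Fin m → T) (i l : Fin m) :
    symProd T m g h i l = if i = l then g i * h i else g i * h l + g l * h i := rfl

theorem symProd_comm (g h : Fin m → T) : symProd T m g h = symProd T m h g := by
  ext i l
  rw [symProd_apply, symProd_apply]
  by_cases e : i = l
  · simp [e, mul_comm]
  · simp [e]; ring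

theorem symProd_single_single (a l : Fin m) (s : T) :
    symProd T m (Pi.single a 1) (Pi.single l s) = symProd T m (Pi.single l 1) (Pi.single a s) := by
  have h : ∀ j : Fin m, (Pi.single j s : Fin m → T) = s • Pi.single j 1 := fun j => by
    rw [← Pi.single_smul]; simp
  rw [h, h, map_smul, map_smul, symProd_comm]

/-- The quadratic forms in the ideal generated by the linear forms given by the columns. -/
def quadSpan (X : Matrix (Fin m) (Fin r) T) : Submodule T (Fin m → Fin m → T) :=
  LinearMap.range (∑ j, (symProd T m (fun i => X i j)) ∘ₗ
    (LinearMap.proj j : (Fin r → Fin m → T) →ₗ[T] (Fin m → T)))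

theorem mem_quadSpan {X : Matrix (Fin m) (Fin r) T} {q : Fin m → Fin m → T} :
    q ∈ quadSpan X ↔ ∃ H : Fin r → Fin m → T, ∑ j, symProd T m (fun i => X i j) (H j) = q := by
  simp [quadSpan, LinearMap.mem_range, LinearMap.sum_apply]

/-- The submodule generated by the columns. -/
def colSpan (X : Matrix (Fin m) (Fin r) T) : Submodule T (Fin m → T) :=
  LinearMap.range X.mulVecLin

theorem mem_colSpan {X : Matrix (Fin m) (Fin r) T} {g : Fin m → T} :
    g ∈ colSpan X ↔ ∃ c : Fin r → T, X.mulVec c = g := by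
  simp [colSpan, LinearMap.mem_range]

theorem mulVec_eq_sum_smul (X : Matrix (Fin m) (Fin r) T) (c : Fin r → T) :
    X.mulVec c = ∑ j, c j • (fun i => X i j) := by
  ext i
  simp [Matrix.mulVec, dotProduct, mul_comm]

theorem symProd_mem_quadSpan {X : Matrix (Fin m) (Fin r) T} {g : Fin m → T} (hg : g ∈ colSpan X)
    (w : Fin m → T) : symProd T m w g ∈ quadSpan X := by
  obtain ⟨c, rfl⟩ := mem_colSpan.1 hg
  refine mem_quadSpan.2 ⟨fun j => c j • w, ?_⟩
  rw [mulVec_eq_sum_smul, map_sum]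
  refine Finset.sum_congr rfl fun j _ => ?_
  rw [map_smul, map_smul, symProd_comm]

/-- Multiplication by the linear form `w` is injective on linear forms modulo the columns of
`X`. -/
def ColRegular (X : Matrix (Fin m) (Fin r) T) (w : Fin m → T) : Prop :=
  ∀ g, symProd T m w g ∈ quadSpan X → g ∈ colSpan X

theorem mem_colSpan_succ {X : Matrix (Fin m) (Fin (r + 1)) T} {g : Fin m → T} :
    g ∈ colSpan X ↔ ∃ b : T, g - b • (fun i => X i (Fin.last r)) ∈
      colSpan (X.submatrix id Fin.castSucc) := by
  constructor
  · intro h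
    obtain ⟨c, rfl⟩ := mem_colSpan.1 h
    refine ⟨c (Fin.last r), mem_colSpan.2 ⟨fun j => c j.castSucc, ?_⟩⟩
    rw [mulVec_eq_sum_smul, mulVec_eq_sum_smul, Fin.sum_univ_castSucc, add_sub_cancel_right]
    rfl
  · rintro ⟨b, h⟩
    obtain ⟨c, hc⟩ := mem_colSpan.1 h
    refine mem_colSpan.2 ⟨Fin.snoc c b, ?_⟩
    rw [mulVec_eq_sum_smul, Fin.sum_univ_castSucc]
    simp only [Fin.snoc_castSucc, Fin.snoc_last]
    rw [mulVec_eq_sum_smul] at hc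
    exact eq_sub_iff_add_eq.1 hc

theorem colSpan_submatrix_le (X : Matrix (Fin m) (Fin (r + 1)) T) :
    colSpan (X.submatrix id Fin.castSucc) ≤ colSpan X :=
  fun g hg => mem_colSpan_succ.2 ⟨0, by simpa using hg⟩

theorem comp_castSucc_mem_colSpan {X : Matrix (Fin (m + 1)) (Fin r) T} {g : Fin (m + 1) → T}
    (hg : g ∈ colSpan X) : (fun i => g (Fin.castSucc i)) ∈
      colSpan (X.submatrix Fin.castSucc id) := by
  obtain ⟨c, rfl⟩ := mem_colSpan.1 hg
  exact mem_colSpan.2 ⟨c, rfl⟩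

theorem exists_of_comp_castSucc_mem_colSpan {X : Matrix (Fin (m + 1)) (Fin r) T}
    {g : Fin (m + 1) → T}
    (hg : (fun i => g (Fin.castSucc i)) ∈ colSpan (X.submatrix Fin.castSucc id)) :
    ∃ b : T, g - Pi.single (Fin.last m) b ∈ colSpan X := by
  obtain ⟨c, hc⟩ := mem_colSpan.1 hg
  refine ⟨g (Fin.last m) - X.mulVec c (Fin.last m), mem_colSpan.2 ⟨c, ?_⟩⟩
  ext i
  refine Fin.lastCases ?_ (fun i => ?_) i
  · simp
  · have := congrFun hc i
    simp only [Pi.sub_apply]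
    rw [Pi.single_eq_of_ne (Fin.castSucc_lt_last i).ne, sub_zero, ← this]
    rfl

/-- Regularity of the last variable passes to the matrix with one more column. -/
theorem ColRegular.last_succ {X : Matrix (Fin (m + 1)) (Fin (r + 1)) T}
    (h₁ : ColRegular (X.submatrix id Fin.castSucc) (Pi.single (Fin.last m) 1))
    (h₂ : ColRegular (X.submatrix Fin.castSucc Fin.castSucc)
      (fun i => X (Fin.castSucc i) (Fin.last r))) :
    ColRegular X (Pi.single (Fin.last m) 1) := by
  intro g hg
  obtain ⟨H, hH⟩ := mem_quadSpan.1 hg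
  rw [Fin.sum_univ_castSucc] at hH
  set h := H (Fin.last r) with hh
  set w : Fin (m + 1) → T := fun i => X i (Fin.last r) with hw
  -- Setting the last variable to zero removes the product with `g` and leaves `w * h` in the span
  -- of the earlier columns. Hence `h` is `b` times the last variable modulo those columns, and `g -
  -- b • w` satisfies the original relation without the last column.
  have h3 : (fun i => h (Fin.castSucc i)) ∈ colSpan (X.submatrix Fin.castSucc Fin.castSucc) := by
    apply h₂
    refine mem_quadSpan.2 ⟨fun j i => - H j.castSucc i.castSucc, ?_⟩
    ext i l
    have := congrFun (congrFun hH i.castSucc) l.castSucc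
    simp only [Pi.add_apply, Finset.sum_apply, symProd_apply] at this ⊢
    simp only [Fin.castSucc_inj, Pi.single_eq_of_ne (Fin.castSucc_lt_last _).ne, zero_mul,
      add_zero, ite_self] at this
    rw [← eq_neg_iff_add_eq_zero] at this
    by_cases e : i = l
    · simp only [e, if_true, Matrix.submatrix_apply, mul_neg, Finset.sum_neg_distrib] at this ⊢
      rw [this]; simp [hw]
    · simp only [e, if_false, Matrix.submatrix_apply, mul_neg, ← neg_add,
        Finset.sum_neg_distrib] at this ⊢
      rw [this]; simp [hw]
  obtain ⟨b, hb⟩ := exists_of_comp_castSucc_mem_colSpan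
    (X := X.submatrix id Fin.castSucc) (g := h) h3
  refine mem_colSpan_succ.2 ⟨b, h₁ _ ?_⟩
  have e1 : symProd T (m + 1) (Pi.single (Fin.last m) 1) (b • w) =
      symProd T (m + 1) w (Pi.single (Fin.last m) b) := by
    have : (Pi.single (Fin.last m) b : Fin (m + 1) → T) = b • Pi.single (Fin.last m) 1 := by
      rw [← Pi.single_smul]; simp
    rw [this, map_smul, map_smul, symProd_comm]
  rw [map_sub, ← hH, e1]
  have e2 : symProd T (m + 1) w h - symProd T (m + 1) w (Pi.single (Fin.last m) b) ∈
      quadSpan (X.submatrix id Fin.castSucc) := by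
    rw [← map_sub]
    exact symProd_mem_quadSpan hb w
  rw [add_sub_assoc]
  exact Submodule.add_mem _ (mem_quadSpan.2 ⟨fun j => H j.castSucc, rfl⟩) e2

theorem colRegular_last_zero (X : Matrix (Fin (m + 1)) (Fin 0) T) :
    ColRegular X (Pi.single (Fin.last m) 1) := by
  intro g hg
  obtain ⟨H, hH⟩ := mem_quadSpan.1 hg
  have : g = 0 := by
    ext i
    have := congrFun (congrFun hH i) (Fin.last m)
    rw [symProd_apply] at this
    by_cases e : i = Fin.last m
    · subst e; simpa using this.symm
    · simpa [e] using this.symm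
  rw [this]
  exact Submodule.zero_mem _

theorem colRegular_fin_zero (X : Matrix (Fin 0) (Fin r) T) (w : Fin 0 → T) : ColRegular X w :=
  fun g _ => by rw [Subsingleton.elim g 0]; exact Submodule.zero_mem _

theorem ColRegular.of_ringEquiv {T' : Type u} [CommRing T'] (e : T ≃+* T')
    {X : Matrix (Fin m) (Fin r) T} {w : Fin m → T}
    (h : ColRegular (X.map e) (fun i => e (w i))) : ColRegular X w := by
  intro g hg
  obtain ⟨H, hH⟩ := mem_quadSpan.1 hg
  have h1 := h (fun i => e (g i)) (mem_quadSpan.2 ⟨fun j i => e (H j i), by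
    ext i l
    have := congrArg e (congrFun (congrFun hH i) l)
    simp only [Finset.sum_apply, symProd_apply, map_sum, apply_ite e, map_mul, map_add,
      Matrix.map_apply] at this ⊢
    exact this⟩)
  obtain ⟨c, hc⟩ := mem_colSpan.1 h1
  refine mem_colSpan.2 ⟨fun j => e.symm (c j), ?_⟩
  ext i
  apply e.injective
  rw [← congrFun hc i]
  simp [Matrix.mulVec, dotProduct, map_sum]

open Polynomial in
/-- A new column whose last entry is a power of a new variable is regular. -/
theorem ColRegular.map_C {X : Matrix (Fin (m + 1)) (Fin r) T}
    (h : ColRegular X (Pi.single (Fin.last m) 1)) {e : ℕ} (he : 0 < e) (w : Fin (m + 1) → T[X])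
    (hw : w (Fin.last m) = Polynomial.X ^ e) (hw' : ∀ i : Fin m, ∃ b, w i.castSucc = C b) :
    ColRegular (X.map C) w := by
  -- Induction on a degree bound: the vector of top coefficients of `g` lies in the column span by
  -- `h`, and is subtracted off.
  suffices H : ∀ (N : ℕ) (g : Fin (m + 1) → T[X]), (∀ i, (g i).degree < N) →
      symProd _ _ w g ∈ quadSpan (X.map C) → g ∈ colSpan (X.map C) by
    intro g hg
    refine H (Finset.univ.sup (fun i => (g i).natDegree) + 1) g (fun i => ?_) hg
    refine lt_of_le_of_lt degree_le_natDegree ?_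
    have : (g i).natDegree ≤ Finset.univ.sup (fun i => (g i).natDegree) :=
      Finset.le_sup (f := fun i => (g i).natDegree) (Finset.mem_univ i)
    exact_mod_cast Nat.lt_succ_of_le this
  intro N
  induction N with
  | zero =>
    intro g hg _
    have : g = 0 := by
      ext1 i
      have := hg i
      simpa using this
    rw [this]
    exact Submodule.zero_mem _
  | succ N ih =>
    intro g hg hmem
    let b : Fin (m + 1) → T := fun i => (g i).coeff N
    -- In degree `N + e` the constant entries of `w` contribute nothing since `e > 0`; only the
    -- power of the new variable does.
    have hcoeff : ∀ i l, (w i * g l).coeff (N + e) =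
        (Pi.single (Fin.last m) 1 : Fin (m + 1) → T) i * b l := by
      intro i l
      refine Fin.lastCases ?_ (fun i => ?_) i
      · rw [hw, coeff_X_pow_mul]; simp [b]
      · obtain ⟨c, hc⟩ := hw' i
        rw [hc, coeff_C_mul, Pi.single_eq_of_ne (Fin.castSucc_lt_last _).ne, zero_mul,
          coeff_eq_zero_of_degree_lt, mul_zero]
        refine (hg l).trans_le ?_
        exact_mod_cast Nat.add_le_add_left he N
    obtain ⟨H, hH⟩ := mem_quadSpan.1 hmem
    have hb : b ∈ colSpan X := by
      refine h _ (mem_quadSpan.2 ⟨fun j i => (H j i).coeff (N + e), ?_⟩)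
      ext i l
      have := congrArg (fun p => p.coeff (N + e)) (congrFun (congrFun hH i) l)
      simp only [Finset.sum_apply, symProd_apply, finsetSum_coeff, Matrix.map_apply,
        apply_ite (fun p : T[X] => p.coeff (N + e)), coeff_add, coeff_C_mul, hcoeff] at this ⊢
      rw [← this]
    obtain ⟨c, hc⟩ := mem_colSpan.1 hb
    have hCb : (fun i => C (b i)) ∈ colSpan (X.map C) := by
      refine mem_colSpan.2 ⟨fun j => C (c j), ?_⟩
      ext1 i
      rw [← hc]
      simp [Matrix.mulVec, dotProduct, map_sum]
    have hXb : (Polynomial.X ^ N : T[X]) • (fun i => C (b i)) ∈ colSpan (X.map C) :=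
      Submodule.smul_mem _ _ hCb
    have hg' : g - (Polynomial.X ^ N : T[X]) • (fun i => C (b i)) ∈ colSpan (X.map C) := by
      refine ih _ (fun i => ?_) ?_
      · rw [degree_lt_iff_coeff_zero]
        intro n hn
        simp only [Pi.sub_apply, Pi.smul_apply, smul_eq_mul, coeff_sub, coeff_X_pow_mul', coeff_C]
        rcases hn.eq_or_lt with rfl | hn
        · simp [b]
        · rw [coeff_eq_zero_of_degree_lt ((hg i).trans_le (by exact_mod_cast hn))]
          simp [hn.le, (Nat.sub_pos_of_lt hn).ne']
      · rw [map_sub]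
        exact Submodule.sub_mem _ hmem (symProd_mem_quadSpan hXb w)
    simpa using Submodule.add_mem _ hg' hXb

end SymProd

/-! ### Regularity for matrices of powers of independent variables -/

section Generic

open MvPolynomial

/-- The matrix of `e`-th powers of the variables indexed by `ι`. -/
def powMatrix (k : Type u) [CommRing k] {σ : Type} (e : ℕ) {m r : ℕ} (ι : Fin m → Fin r → σ) :
    Matrix (Fin m) (Fin r) (MvPolynomial σ k) :=
  Matrix.of fun i j => X (ι i j) ^ e

variable (k : Type u) [CommRing k]

/-- Multivariate polynomials as polynomials in one of the variables. -/
theorem exists_ringEquiv_polynomial {σ : Type} (s : σ) :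
    ∃ E : MvPolynomial σ k ≃+* Polynomial (MvPolynomial {j : σ // j ≠ s} k),
      E (X s) = Polynomial.X ∧ ∀ j (hj : j ≠ s), E (X j) = Polynomial.C (X ⟨j, hj⟩) := by
  classical
  refine ⟨((renameEquiv k (Equiv.optionSubtypeNe s).symm).trans
    (optionEquivLeft k {j : σ // j ≠ s})).toRingEquiv, ?_, fun j hj => ?_⟩
  · simp [optionEquivLeft_apply]
  · simp [optionEquivLeft_apply, Equiv.optionSubtypeNe_symm_of_ne hj]

variable {k} {σ : Type}

/-- Viewed as polynomials in the bottom variable of the last column, all other entries are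
constants, so `ColRegular.map_C` applies. Splitting off that variable changes the index type, whence
the quantifier over `τ`. -/
theorem colRegular_powMatrix_of_last {e : ℕ} (he : 0 < e) {m r : ℕ} (ι : Fin m → Fin (r + 1) → σ)
    (hι : Function.Injective2 ι)
    (h : ∀ (τ : Type) (n : ℕ) (κ : Fin (n + 1) → Fin r → τ), Function.Injective2 κ →
      ColRegular (powMatrix k e κ) (Pi.single (Fin.last n) 1)) :
    ColRegular ((powMatrix k e ι).submatrix id Fin.castSucc)
      (fun i => powMatrix k e ι i (Fin.last r)) := by
  cases m with
  | zero => exact colRegular_fin_zero _ _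
  | succ m =>
    obtain ⟨E, hE, hE'⟩ := exists_ringEquiv_polynomial k (ι (Fin.last m) (Fin.last r))
    have hne : ∀ (i : Fin (m + 1)) (j : Fin r), ι i j.castSucc ≠ ι (Fin.last m) (Fin.last r) :=
      fun i j hij => (Fin.castSucc_lt_last j).ne (hι hij).2
    have hne' : ∀ i : Fin m, ι i.castSucc (Fin.last r) ≠ ι (Fin.last m) (Fin.last r) :=
      fun i hij => (Fin.castSucc_lt_last i).ne (hι hij).1
    refine ColRegular.of_ringEquiv E ?_
    let κ : Fin (m + 1) → Fin r → {j : σ // j ≠ ι (Fin.last m) (Fin.last r)} :=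
      fun i j => ⟨ι i j.castSucc, hne i j⟩
    have hκ : Function.Injective2 κ := fun i i' j j' hij => by
      have := hι (congrArg Subtype.val hij)
      exact ⟨this.1, Fin.castSucc_injective _ this.2⟩
    have key : ((powMatrix k e ι).submatrix id Fin.castSucc).map E =
        (powMatrix k e κ).map Polynomial.C := by
      ext1 i j
      simp [powMatrix, hE' _ (hne i j), κ]
    rw [key]
    refine (h _ _ κ hκ).map_C he _ ?_ fun i => ⟨X ⟨_, hne' i⟩ ^ e, ?_⟩
    · simp [powMatrix, hE]
    · simp [powMatrix, hE' _ (hne' i)]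

/-- Induction on columns: both inputs of `ColRegular.last_succ` concern matrices with one column
fewer, and the second is supplied by `colRegular_powMatrix_of_last` from the induction hypothesis
itself. -/
theorem colRegular_powMatrix_last {e : ℕ} (he : 0 < e) (r : ℕ) :
    ∀ (σ : Type) (m : ℕ) (ι : Fin (m + 1) → Fin r → σ), Function.Injective2 ι →
      ColRegular (powMatrix k e ι) (Pi.single (Fin.last m) 1) := by
  induction r with
  | zero => exact fun σ m ι _ => colRegular_last_zero _
  | succ r ih =>
    intro σ m ι hι
    apply ColRegular.last_succ
    · exact ih σ m (fun i j => ι i j.castSucc) fun i i' j j' hij =>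
        ⟨(hι hij).1, Fin.castSucc_injective _ (hι hij).2⟩
    · exact colRegular_powMatrix_of_last he (fun i j => ι i.castSucc j) (fun i i' j j' hij =>
        ⟨Fin.castSucc_injective _ (hι hij).1, (hι hij).2⟩) ih

theorem colRegular_powMatrix {e : ℕ} (he : 0 < e) {m r : ℕ} (ι : Fin m → Fin (r + 1) → σ)
    (hι : Function.Injective2 ι) :
    ColRegular ((powMatrix k e ι).submatrix id Fin.castSucc)
      (fun i => powMatrix k e ι i (Fin.last r)) :=
  colRegular_powMatrix_of_last he ι hι (colRegular_powMatrix_last he r)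

end Generic

/-! ### Annihilators of cokernels under deletion of a row and a column -/

section Annihilator

variable {T : Type u} [CommRing T] {m r : ℕ}

/-- The annihilator of the cokernel of a matrix. -/
def cokerAnn (X : Matrix (Fin m) (Fin r) T) : Ideal T where
  carrier := {s | ∀ i, Pi.single i s ∈ colSpan X}
  zero_mem' := fun i => by simp
  add_mem' := fun hs ht i => by rw [Pi.single_add]; exact Submodule.add_mem _ (hs i) (ht i)
  smul_mem' := fun c s hs i => by rw [Pi.single_smul]; exact Submodule.smul_mem _ c (hs i)

theorem smul_mem_colSpan {X : Matrix (Fin m) (Fin r) T} {s : T} (hs : s ∈ cokerAnn X)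
    (w : Fin m → T) : s • w ∈ colSpan X := by
  have : s • w = ∑ i, w i • (Pi.single i s : Fin m → T) := by
    ext j
    simp [Finset.sum_apply, Pi.single_apply, mul_comm]
  rw [this]
  exact Submodule.sum_mem _ fun i _ => Submodule.smul_mem _ _ (hs i)

theorem cokerAnn_submatrix_le (X : Matrix (Fin m) (Fin (r + 1)) T) :
    cokerAnn (X.submatrix id Fin.castSucc) ≤ cokerAnn X :=
  fun _ hs i => colSpan_submatrix_le X (hs i)

theorem cokerAnn_le_submatrix (X : Matrix (Fin (m + 1)) (Fin r) T) :
    cokerAnn X ≤ cokerAnn (X.submatrix Fin.castSucc id) := by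
  intro s hs i
  convert comp_castSucc_mem_colSpan (hs i.castSucc) using 1
  ext j
  simp [Pi.single_apply]

/-- In the symmetric square, `e_last * (s e_l) = e_l * (s e_last)` is zero modulo the columns;
cancel `e_last`. -/
theorem ColRegular.mem_cokerAnn {X : Matrix (Fin (m + 1)) (Fin r) T}
    (h : ColRegular X (Pi.single (Fin.last m) 1)) {s : T}
    (hs : Pi.single (Fin.last m) s ∈ colSpan X) : s ∈ cokerAnn X := fun l =>
  h _ (by rw [symProd_single_single]; exact symProd_mem_quadSpan hs _)

theorem symProd_single_smul (w : Fin m → T) (l : Fin m) (g : T) :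
    symProd T m (Pi.single l 1) (g • w) = symProd T m w (Pi.single l g) := by
  have : (Pi.single l g : Fin m → T) = g • Pi.single l 1 := by
    rw [← Pi.single_smul]; simp
  rw [this, map_smul, map_smul, symProd_comm]

theorem ColRegular.mem_cokerAnn_of_smul {X : Matrix (Fin m) (Fin r) T} {w : Fin m → T}
    (h : ColRegular X w) {g : T} (hg : g • w ∈ colSpan X) : g ∈ cokerAnn X := fun l =>
  h _ (by rw [← symProd_single_smul]; exact symProd_mem_quadSpan hg _)

/-- Pairs `(s, g)` such that `s` times the last basis vector is `g` times the last column, modulo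
the other columns. -/
def lastRel (X : Matrix (Fin (m + 1)) (Fin (r + 1)) T) : Submodule T (T × T) :=
  Submodule.comap
    ((LinearMap.single T (fun _ : Fin (m + 1) => T) (Fin.last m)) ∘ₗ LinearMap.fst T T T -
      (LinearMap.toSpanSingleton T (Fin (m + 1) → T) (fun i => X i (Fin.last r))) ∘ₗ
        LinearMap.snd T T T)
    (colSpan (X.submatrix id Fin.castSucc))

theorem mem_lastRel {X : Matrix (Fin (m + 1)) (Fin (r + 1)) T} {s g : T} :
    (s, g) ∈ lastRel X ↔ Pi.single (Fin.last m) s - g • (fun i => X i (Fin.last r)) ∈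
      colSpan (X.submatrix id Fin.castSucc) := Iff.rfl

theorem fst_mem_of_mem_lastRel {X : Matrix (Fin (m + 1)) (Fin (r + 1)) T}
    (h : ColRegular X (Pi.single (Fin.last m) 1)) {s g : T} (hsg : (s, g) ∈ lastRel X) :
    s ∈ cokerAnn X :=
  h.mem_cokerAnn (mem_colSpan_succ.2 ⟨g, hsg⟩)

theorem exists_snd_mem_lastRel {X : Matrix (Fin (m + 1)) (Fin (r + 1)) T} {s : T}
    (hs : s ∈ cokerAnn X) : ∃ g, (s, g) ∈ lastRel X :=
  mem_colSpan_succ.1 (hs (Fin.last m))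

/-- With `w` the last column, `s e_last ≡ g w` and `s e_l ≡ gl w` modulo the other columns.
Cross-multiplying by `e_l` and `e_last` gives `w * (g e_l - gl e_last) ≡ 0`; cancel `w` and drop the
last row. -/
theorem snd_mem_of_mem_lastRel {X : Matrix (Fin (m + 1)) (Fin (r + 1)) T}
    (hX : ColRegular X (Pi.single (Fin.last m) 1))
    (h : ColRegular (X.submatrix id Fin.castSucc) (fun i => X i (Fin.last r)))
    {s g : T} (hsg : (s, g) ∈ lastRel X) :
    g ∈ cokerAnn (X.submatrix Fin.castSucc Fin.castSucc) := by
  intro l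
  obtain ⟨gl, hgl⟩ := mem_colSpan_succ.1 (fst_mem_of_mem_lastRel hX hsg l.castSucc)
  have key : Pi.single l.castSucc g - Pi.single (Fin.last m) gl ∈
      colSpan (X.submatrix id Fin.castSucc) := by
    apply h
    have h1 := symProd_mem_quadSpan hgl (Pi.single (Fin.last m) 1)
    have h2 := symProd_mem_quadSpan (mem_lastRel.1 hsg) (Pi.single l.castSucc 1)
    have := Submodule.sub_mem _ h1 h2
    rw [map_sub, map_sub, symProd_single_single, sub_sub_sub_cancel_left, symProd_single_smul,
      symProd_single_smul, ← map_sub] at this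
    exact this
  have e := comp_castSucc_mem_colSpan key
  have e' : (fun i : Fin m => (Pi.single l.castSucc g - Pi.single (Fin.last m) gl :
      Fin (m + 1) → T) (Fin.castSucc i)) = Pi.single l g := by
    ext j
    simp [Pi.single_apply, (Fin.castSucc_lt_last j).ne]
  rw [e'] at e
  exact e

theorem exists_fst_mem_lastRel {X : Matrix (Fin (m + 1)) (Fin (r + 1)) T} {g : T}
    (hg : g ∈ cokerAnn (X.submatrix Fin.castSucc Fin.castSucc)) : ∃ s, (s, g) ∈ lastRel X := by
  have h1 := smul_mem_colSpan hg (fun i => X i.castSucc (Fin.last r))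
  obtain ⟨b, hb⟩ := exists_of_comp_castSucc_mem_colSpan (X := X.submatrix id Fin.castSucc)
    (g := g • fun i => X i (Fin.last r)) h1
  refine ⟨b, mem_lastRel.2 ?_⟩
  rw [← neg_sub]
  exact Submodule.neg_mem _ hb

/-- This makes the correspondence `lastRel` descend to an isomorphism modulo the annihilator for the
matrix without its last column. -/
theorem fst_mem_iff_snd_mem {X : Matrix (Fin (m + 1)) (Fin (r + 1)) T}
    (hP : ColRegular (X.submatrix id Fin.castSucc) (Pi.single (Fin.last m) 1))
    (hC : ColRegular (X.submatrix id Fin.castSucc) (fun i => X i (Fin.last r)))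
    {s g : T} (hsg : (s, g) ∈ lastRel X) :
    s ∈ cokerAnn (X.submatrix id Fin.castSucc) ↔ g ∈ cokerAnn (X.submatrix id Fin.castSucc) := by
  rw [mem_lastRel] at hsg
  constructor
  · intro hs
    apply hC.mem_cokerAnn_of_smul
    simpa using Submodule.sub_mem _ (hs (Fin.last m)) hsg
  · intro hg
    apply hP.mem_cokerAnn
    simpa using Submodule.add_mem _ hsg (smul_mem_colSpan hg (fun i => X i (Fin.last r)))

end Annihilator

/-! ### The annihilator of the cokernel is the ideal of maximal minors -/

section Minors

variable {T : Type u} [CommRing T] {m r : ℕ}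

theorem Matrix.minorsIdeal_zero (X : Matrix (Fin m) (Fin r) T) : X.minorsIdeal 0 = ⊤ := by
  rw [Ideal.eq_top_iff_one]
  exact Ideal.subset_span ⟨Fin.castLEOrderEmb (Nat.zero_le _), Fin.castLEOrderEmb (Nat.zero_le _),
    by simp⟩

theorem orderEmbedding_fin_eq_id (f : Fin m ↪o Fin m) : (f : Fin m → Fin m) = id :=
  (f.strictMono.range_inj strictMono_id).1 (by
    rw [Set.range_id, Set.range_eq_univ]
    exact Finite.surjective_of_injective f.injective)

theorem Matrix.minorsIdeal_submatrix_castSucc_le (X : Matrix (Fin m) (Fin (r + 1)) T) (t : ℕ) :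
    (X.submatrix id Fin.castSucc).minorsIdeal t ≤ X.minorsIdeal t := by
  refine Ideal.span_le.2 ?_
  rintro _ ⟨f, g, rfl⟩
  exact Ideal.subset_span ⟨f, g.trans Fin.castSuccOrderEmb, rfl⟩

theorem col_mem_colSpan (X : Matrix (Fin m) (Fin r) T) (j : Fin r) :
    (fun i => X i j) ∈ colSpan X :=
  mem_colSpan.2 ⟨Pi.single j 1, by ext i; simp⟩

/-- Cramer's rule: the adjugate expresses `det • e_i` through the chosen columns. -/
theorem minorsIdeal_le_cokerAnn (X : Matrix (Fin m) (Fin r) T) :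
    X.minorsIdeal m ≤ cokerAnn X := by
  refine Ideal.span_le.2 ?_
  rintro _ ⟨f, g, rfl⟩ i
  rw [orderEmbedding_fin_eq_id f]
  have h : Pi.single i (X.submatrix id g).det =
      (X.submatrix id g).mulVec ((X.submatrix id g).adjugate.mulVec (Pi.single i 1)) := by
    rw [Matrix.mulVec_mulVec, Matrix.mul_adjugate, Matrix.smul_mulVec, Matrix.one_mulVec,
      ← Pi.single_smul, smul_eq_mul, mul_one]
  rw [h, mulVec_eq_sum_smul]
  exact Submodule.sum_mem _ fun j _ => Submodule.smul_mem _ _ (col_mem_colSpan X (g j))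

/-- Border a minor of the corner block by the last row and column. Cramer's rule for the bordered
minor has the original minor as coefficient of the last column. -/
theorem exists_mem_minorsIdeal_mem_lastRel (X : Matrix (Fin (m + 1)) (Fin (r + 1)) T) {g : T}
    (hg : g ∈ (X.submatrix Fin.castSucc Fin.castSucc).minorsIdeal m) :
    ∃ s ∈ X.minorsIdeal (m + 1), (s, g) ∈ lastRel X := by
  induction hg using Submodule.span_induction with
  | zero => exact ⟨0, Ideal.zero_mem _, Submodule.zero_mem _⟩
  | add x y _ _ hx hy =>
    obtain ⟨s, hs, hs'⟩ := hx
    obtain ⟨t, ht, ht'⟩ := hy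
    exact ⟨s + t, Ideal.add_mem _ hs ht, Submodule.add_mem _ hs' ht'⟩
  | smul a x _ hx =>
    obtain ⟨s, hs, hs'⟩ := hx
    exact ⟨a * s, Ideal.mul_mem_left _ _ hs, Submodule.smul_mem _ a hs'⟩
  | mem x hx =>
    obtain ⟨f, c, rfl⟩ := hx
    let c' : Fin (m + 1) → Fin (r + 1) := Fin.lastCases (Fin.last r) fun j => (c j).castSucc
    have hl : c' (Fin.last m) = Fin.last r := Fin.lastCases_last ..
    have hc : ∀ j : Fin m, c' j.castSucc = (c j).castSucc := fun j => Fin.lastCases_castSucc ..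
    have hmono : StrictMono c' := by
      intro i j hij
      induction j using Fin.lastCases with
      | last =>
        induction i using Fin.lastCases with
        | last => exact absurd hij (lt_irrefl _)
        | cast i => rw [hl, hc]; exact Fin.castSucc_lt_last _
      | cast j =>
        induction i using Fin.lastCases with
        | last => exact absurd hij (Fin.castSucc_lt_last j).le.not_gt
        | cast i => rw [hc, hc]; exact Fin.castSucc_lt_castSucc_iff.2
                      (c.strictMono (Fin.castSucc_lt_castSucc_iff.1 hij))
    set B := X.submatrix id c' with hB
    refine ⟨B.det, Ideal.subset_span ⟨(OrderIso.refl _).toOrderEmbedding,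
      OrderEmbedding.ofStrictMono c' hmono, rfl⟩, mem_lastRel.2 ?_⟩
    have h : Pi.single (Fin.last m) B.det =
        B.mulVec (B.adjugate.mulVec (Pi.single (Fin.last m) 1)) := by
      rw [Matrix.mulVec_mulVec, Matrix.mul_adjugate, Matrix.smul_mulVec, Matrix.one_mulVec,
        ← Pi.single_smul, smul_eq_mul, mul_one]
    have h' : (B.adjugate.mulVec (Pi.single (Fin.last m) 1)) (Fin.last m) =
        ((X.submatrix Fin.castSucc Fin.castSucc).submatrix f c).det := by
      rw [Matrix.mulVec_single_one, Matrix.col_apply, Matrix.adjugate_fin_succ_eq_det_submatrix,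
        Fin.succAbove_last, ← two_mul, pow_mul, neg_one_sq, one_pow, one_mul,
        orderEmbedding_fin_eq_id f]
      congr 1
      ext i j
      simp [hB, hc]
    rw [h, mulVec_eq_sum_smul, Fin.sum_univ_castSucc, h']
    have h'' : (fun i => B i (Fin.last m)) = fun i => X i (Fin.last r) := by
      ext i; simp [hB, hl]
    rw [h'', add_sub_cancel_right]
    refine Submodule.sum_mem _ fun j _ => Submodule.smul_mem _ _ ?_
    convert col_mem_colSpan (X.submatrix id Fin.castSucc) (c j) using 1
    ext i
    simp [hB, hc]

/-- The partner `g` of `s` under `lastRel` lies by induction in the minors of the corner block, so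
it has another partner `s₀` among the minors. Then `s - s₀` is paired with `0`, hence annihilates
the cokernel for the first `r` columns, and induction applies to it. -/
theorem cokerAnn_powMatrix_le {k : Type u} [CommRing k] {e : ℕ} (he : 0 < e) {σ : Type} (r : ℕ) :
    ∀ (m : ℕ) (ι : Fin m → Fin r → σ), Function.Injective2 ι →
      cokerAnn (powMatrix k e ι) ≤ (powMatrix k e ι).minorsIdeal m := by
  induction r with
  | zero =>
    rintro (_ | m) ι hι s hs
    · rw [Matrix.minorsIdeal_zero]; trivial
    · obtain ⟨c, hc⟩ := mem_colSpan.1 (hs (Fin.last m))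
      have := congrFun hc (Fin.last m)
      rw [Pi.single_eq_same] at this
      rw [← this, mulVec_eq_sum_smul]
      simp
  | succ r ih =>
    rintro (_ | m) ι hι s hs
    · rw [Matrix.minorsIdeal_zero]; trivial
    · have hC := colRegular_powMatrix (k := k) he ι hι
      have hX := colRegular_powMatrix_last (k := k) he _ _ _ ι hι
      have hιP : Function.Injective2 fun i (j : Fin r) => ι i j.castSucc := fun i i' j j' hij =>
        ⟨(hι hij).1, Fin.castSucc_injective _ (hι hij).2⟩
      have hP : ColRegular ((powMatrix k e ι).submatrix id Fin.castSucc)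
          (Pi.single (Fin.last m) 1) := colRegular_powMatrix_last (k := k) he _ _ _ _ hιP
      obtain ⟨g, hg⟩ := exists_snd_mem_lastRel hs
      have hg' := ih m (fun i j => ι i.castSucc j.castSucc) (fun i i' j j' hij =>
        ⟨Fin.castSucc_injective _ (hι hij).1, Fin.castSucc_injective _ (hι hij).2⟩)
        (snd_mem_of_mem_lastRel hX hC hg)
      obtain ⟨s₀, hs₀, h₀⟩ := exists_mem_minorsIdeal_mem_lastRel (powMatrix k e ι) hg'
      have hd : (s - s₀, (0 : MvPolynomial σ k)) ∈ lastRel (powMatrix k e ι) := by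
        have := Submodule.sub_mem _ hg h₀
        rwa [Prod.mk_sub_mk, sub_self] at this
      have h₁ : s - s₀ ∈ cokerAnn ((powMatrix k e ι).submatrix id Fin.castSucc) :=
        (fst_mem_iff_snd_mem hP hC hd).2 (Ideal.zero_mem _)
      have h₂ := Matrix.minorsIdeal_submatrix_castSucc_le (powMatrix k e ι) _ (ih (m + 1) _ hιP h₁)
      rw [← sub_add_cancel s s₀]
      exact Ideal.add_mem _ h₂ hs₀

theorem cokerAnn_powMatrix {k : Type u} [CommRing k] {e : ℕ} (he : 0 < e) {σ : Type} {m r : ℕ}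
    (ι : Fin m → Fin r → σ) (hι : Function.Injective2 ι) :
    cokerAnn (powMatrix k e ι) = (powMatrix k e ι).minorsIdeal m :=
  (cokerAnn_powMatrix_le he r m ι hι).antisymm (minorsIdeal_le_cokerAnn _)

theorem Matrix.minorsIdeal_eq_bot (X : Matrix (Fin m) (Fin r) T) {t : ℕ} (h : r < t) :
    X.minorsIdeal t = ⊥ := by
  refine le_bot_iff.1 (Ideal.span_le.2 ?_)
  rintro _ ⟨f, g, rfl⟩
  have := Fintype.card_le_of_injective g g.injective
  simp only [Fintype.card_fin] at this
  omega

end Minors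

/-! ### Projective dimension of determinantal quotients -/

section ProjectiveDimension

variable {T : Type u} [CommRing T]

/-- Transfer of projective dimension through a correspondence between two ideals `J₁` and `J₂`
which induces an isomorphism `J₁ / I ≃ J₂ / I`. -/
theorem hasProjectiveDimensionLT_quotient_of_correspondence {I J₁ J₂ : Ideal T}
    (L : Submodule T (T × T)) (h₁ : I ≤ J₁) (h₂ : I ≤ J₂)
    (hL : ∀ x ∈ L, x.1 ∈ J₁ ∧ x.2 ∈ J₂) (hs₁ : ∀ s ∈ J₁, ∃ g, (s, g) ∈ L)
    (hs₂ : ∀ g ∈ J₂, ∃ s, (s, g) ∈ L) (hI : ∀ x ∈ L, x.1 ∈ I ↔ x.2 ∈ I) {n : ℕ}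
    (hpI : HasProjectiveDimensionLT (ModuleCat.of T (T ⧸ I)) n)
    (hp₂ : HasProjectiveDimensionLT (ModuleCat.of T (T ⧸ J₂)) (n + 1)) :
    HasProjectiveDimensionLT (ModuleCat.of T (T ⧸ J₁)) (n + 1) := by
  -- The two projections of `L` to `T ⧸ I` have a common kernel, and images `J₁ / I` and `J₂ / I`.
  let f₁ : L →ₗ[T] T ⧸ I := I.mkQ ∘ₗ LinearMap.fst T T T ∘ₗ L.subtype
  let f₂ : L →ₗ[T] T ⧸ I := I.mkQ ∘ₗ LinearMap.snd T T T ∘ₗ L.subtype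
  have hker : LinearMap.ker f₁ = LinearMap.ker f₂ := by
    ext x
    simpa [f₁, f₂, Ideal.Quotient.eq_zero_iff_mem] using hI _ x.2
  have hr₁ : LinearMap.range f₁ = LinearMap.ker (Submodule.factor h₁) := by
    ext y
    obtain ⟨y, rfl⟩ := I.mkQ_surjective y
    constructor
    · rintro ⟨x, hx⟩
      rw [← hx]
      simpa [f₁, Ideal.Quotient.eq_zero_iff_mem] using (hL _ x.2).1
    · intro hy
      obtain ⟨g, hg⟩ := hs₁ y (by simpa [Ideal.Quotient.eq_zero_iff_mem] using hy)
      exact ⟨⟨_, hg⟩, rfl⟩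
  have hr₂ : LinearMap.range f₂ = LinearMap.ker (Submodule.factor h₂) := by
    ext y
    obtain ⟨y, rfl⟩ := I.mkQ_surjective y
    constructor
    · rintro ⟨x, hx⟩
      rw [← hx]
      simpa [f₂, Ideal.Quotient.eq_zero_iff_mem] using (hL _ x.2).2
    · intro hy
      obtain ⟨g, hg⟩ := hs₂ y (by simpa [Ideal.Quotient.eq_zero_iff_mem] using hy)
      exact ⟨⟨_, hg⟩, rfl⟩
  let E : LinearMap.ker (Submodule.factor h₂) ≃ₗ[T] LinearMap.ker (Submodule.factor h₁) :=
    (LinearEquiv.ofEq _ _ hr₂).symm ≪≫ₗ f₂.quotKerEquivRange.symm ≪≫ₗ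
      Submodule.quotEquivOfEq _ _ hker.symm ≪≫ₗ f₁.quotKerEquivRange ≪≫ₗ LinearEquiv.ofEq _ _ hr₁
  have hE₂ := LinearMap.shortExact_shortComplexKer (Submodule.factor_surjective h₂)
  have hE₁ := LinearMap.shortExact_shortComplexKer (Submodule.factor_surjective h₁)
  have hK := hE₂.hasProjectiveDimensionLT_X₁ n hpI hp₂
  exact hE₁.hasProjectiveDimensionLT_X₃ n (hasProjectiveDimensionLT_of_iso E.toModuleIso n)
    (hasProjectiveDimensionLT_of_ge _ n _ n.le_succ)

/-- The strict bound `r + 2 - m` means projective dimension at most `r - m + 1` for `m ≤ r`. In the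
induction the quotient without the last column has a bound smaller by one and the corner block has
the same bound, just as the transfer lemma requires. The quotient is zero for `m = 0`, and free for
`m = r + 1` since there are no `m`-minors. -/
theorem hasProjectiveDimensionLT_powMatrix {k : Type u} [CommRing k] {e : ℕ} (he : 0 < e)
    {σ : Type} (r : ℕ) :
    ∀ (m : ℕ) (ι : Fin m → Fin r → σ), Function.Injective2 ι → m ≤ r + 1 →
      HasProjectiveDimensionLT
        (ModuleCat.of (MvPolynomial σ k) (MvPolynomial σ k ⧸ cokerAnn (powMatrix k e ι)))
        (r + 2 - m) := by
  have h₀ : ∀ (r : ℕ) (ι : Fin 0 → Fin r → σ) (n : ℕ), HasProjectiveDimensionLT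
        (ModuleCat.of (MvPolynomial σ k) (MvPolynomial σ k ⧸ cokerAnn (powMatrix k e ι))) n := by
    intro r ι n
    have : Subsingleton (MvPolynomial σ k ⧸ cokerAnn (powMatrix k e ι)) :=
      Ideal.Quotient.subsingleton_iff.2 ((Ideal.eq_top_iff_one _).2 fun i => i.elim0)
    have := (hasProjectiveDimensionLT_zero_iff_isZero _).2 (ModuleCat.isZero_of_subsingleton
      (ModuleCat.of (MvPolynomial σ k) (MvPolynomial σ k ⧸ cokerAnn (powMatrix k e ι))))
    exact hasProjectiveDimensionLT_of_ge _ 0 _ n.zero_le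
  have h₁ : ∀ (r : ℕ) (ι : Fin (r + 1) → Fin r → σ), Function.Injective2 ι →
      HasProjectiveDimensionLT (ModuleCat.of (MvPolynomial σ k)
        (MvPolynomial σ k ⧸ cokerAnn (powMatrix k e ι))) 1 := by
    intro r ι hι
    rw [← projective_iff_hasProjectiveDimensionLT_one, ← IsProjective.iff_projective]
    have h : cokerAnn (powMatrix k e ι) = ⊥ := by
      rw [cokerAnn_powMatrix he ι hι, Matrix.minorsIdeal_eq_bot _ r.lt_succ_self]
    exact Module.Projective.of_equiv (Submodule.quotEquivOfEqBot _ h).symm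
  induction r with
  | zero =>
    rintro (_ | m) ι hι hm
    · exact h₀ _ _ _
    · obtain rfl : m = 0 := by omega
      exact h₁ _ ι hι
  | succ r ih =>
    rintro (_ | m) ι hι hm
    · exact h₀ _ _ _
    · obtain rfl | hm : m = r + 1 ∨ m ≤ r := by omega
      · convert h₁ _ ι hι using 1
        omega
      have hC := colRegular_powMatrix (k := k) he ι hι
      have hX := colRegular_powMatrix_last (k := k) he _ _ _ ι hι
      have hιP : Function.Injective2 fun i (j : Fin r) => ι i j.castSucc := fun i i' j j' hij =>
        ⟨(hι hij).1, Fin.castSucc_injective _ (hι hij).2⟩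
      have hιQ : Function.Injective2 fun (i : Fin m) (j : Fin r) => ι i.castSucc j.castSucc :=
        fun i i' j j' hij =>
          ⟨Fin.castSucc_injective _ (hι hij).1, Fin.castSucc_injective _ (hι hij).2⟩
      have hP : ColRegular ((powMatrix k e ι).submatrix id Fin.castSucc)
          (Pi.single (Fin.last m) 1) := colRegular_powMatrix_last (k := k) he _ _ _ _ hιP
      have e₁ : r + 1 + 2 - (m + 1) = (r + 2 - (m + 1)) + 1 := by omega
      have e₂ : r + 2 - m = (r + 2 - (m + 1)) + 1 := by omega
      have hQ := ih m _ hιQ (by omega)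
      rw [e₂] at hQ
      rw [e₁]
      exact hasProjectiveDimensionLT_quotient_of_correspondence (lastRel (powMatrix k e ι))
        (cokerAnn_submatrix_le _) (cokerAnn_le_submatrix _)
        (fun x hx => ⟨fst_mem_of_mem_lastRel hX hx, snd_mem_of_mem_lastRel hX hC hx⟩)
        (fun s hs => exists_snd_mem_lastRel hs) (fun g hg => exists_fst_mem_lastRel hg)
        (fun x hx => fst_mem_iff_snd_mem hP hC hx) (ih (m + 1) _ hιP (by omega)) hQ

end ProjectiveDimension

/-! ### The upper bound by Frobenius powers -/

section UpperBound

variable {R : Type u} [CommRing R] {m n : ℕ}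

theorem Matrix.minorsIdeal_map {S : Type u} [CommRing S] (φ : R →+* S)
    (A : Matrix (Fin m) (Fin n) R) (t : ℕ) :
    (A.minorsIdeal t).map φ = (A.map φ).minorsIdeal t := by
  rw [Matrix.minorsIdeal, Ideal.map_span, Matrix.minorsIdeal]
  congr 1
  ext x
  constructor
  · rintro ⟨_, ⟨f, g, rfl⟩, rfl⟩
    exact ⟨f, g, by rw [RingHom.map_det]; rfl⟩
  · rintro ⟨f, g, rfl⟩
    exact ⟨_, ⟨f, g, rfl⟩, by rw [RingHom.map_det]; rfl⟩

theorem Matrix.minorsIdeal_transpose (A : Matrix (Fin m) (Fin n) R) (t : ℕ) :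
    A.transpose.minorsIdeal t = A.minorsIdeal t := by
  rw [Matrix.minorsIdeal, Matrix.minorsIdeal]
  congr 1
  ext x
  constructor
  · rintro ⟨f, g, rfl⟩
    exact ⟨g, f, by rw [← Matrix.det_transpose]; rfl⟩
  · rintro ⟨f, g, rfl⟩
    exact ⟨g, f, by rw [← Matrix.det_transpose]; rfl⟩

/-- Since `I^s ⊆ I^[p^t] ⊆ I^t` for some `s`, the pullback of a class on `R / I^t` to a higher power
factors through `Ext^i(R / I^[p^t], M) = 0`. -/
theorem localCohomologyVanishes_of_frobenius (p : ℕ) [Fact p.Prime] [CharP R p]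
    [IsNoetherianRing R] (I : Ideal R) (d : ℕ)
    (hI : ∀ e, HasProjectiveDimensionLT (ModuleCat.of R (R ⧸ I.map (iterateFrobenius R p e))) d)
    {i : ℕ} (hi : d ≤ i) (M : ModuleCat.{u} R) : LocalCohomologyVanishes I i M := by
  intro t x
  have hp : 1 < p := (Fact.out : p.Prime).one_lt
  have h₁ : I.map (iterateFrobenius R p t) ≤ I ^ t := by
    refine Ideal.map_le_iff_le_comap.2 fun r hr => ?_
    rw [Ideal.mem_comap, iterateFrobenius_def]
    exact Ideal.pow_le_pow_right (Nat.lt_pow_self hp).le (Ideal.pow_mem_pow hr _)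
  obtain ⟨s, hs⟩ : ∃ s, I ^ s ≤ I.map (iterateFrobenius R p t) := by
    refine Ideal.exists_pow_le_of_le_radical_of_fg (fun r hr => ⟨p ^ t, ?_⟩)
      (IsNoetherian.noetherian I)
    rw [← iterateFrobenius_def]
    exact Ideal.mem_map_of_mem _ hr
  have hs' : I ^ max t s ≤ I.map (iterateFrobenius R p t) :=
    (Ideal.pow_le_pow_right (le_max_right _ _)).trans hs
  refine ⟨max t s, le_max_left _ _, ?_⟩
  have := hI t
  rw [← quotientProj_comp hs' h₁, ← Ext.mk₀_comp_mk₀_assoc,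
    Ext.eq_zero_of_hasProjectiveDimensionLT ((Ext.mk₀ (quotientProj h₁)).comp x (zero_add i)) d hi,
    Ext.comp_zero]

theorem localCohomologyVanishes_minorsIdeal_of_prime (p : ℕ) [Fact p.Prime] [CharP R p]
    [IsNoetherianRing R] (hmn : m ≤ n) (A : Matrix (Fin m) (Fin n) R) {i : ℕ}
    (hi : n - m + 1 < i) (M : ModuleCat.{u} R) : LocalCohomologyVanishes (A.minorsIdeal m) i M := by
  obtain ⟨i, rfl⟩ : ∃ j, i = j + 1 := ⟨i - 1, by omega⟩
  let ι : Fin m → Fin n → Fin m × Fin n := Prod.mk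
  have hι : Function.Injective2 ι := fun _ _ _ _ h => Prod.mk.inj h
  let φ : MvPolynomial (Fin m × Fin n) R →+* R := (MvPolynomial.aeval fun x => A x.1 x.2).toRingHom
  have hφ : Function.Surjective φ := fun r => ⟨MvPolynomial.C r, by simp [φ]⟩
  have hA : ((powMatrix R 1 ι).minorsIdeal m).map φ = A.minorsIdeal m := by
    rw [Matrix.minorsIdeal_map]
    congr 1
    ext i j
    simp [powMatrix, φ, ι]
  rw [← hA, ← localCohomologyVanishes_restrictScalars_iff_of_surjective φ hφ]
  refine localCohomologyVanishes_of_frobenius p _ (n + 2 - m) (fun e => ?_) (by omega) _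
  -- Frobenius is a ring homomorphism, so it commutes with determinants. It may alter coefficients
  -- in `R`, but the generic entries are bare variables.
  have h₁ : ((powMatrix R 1 ι).minorsIdeal m).map
      (iterateFrobenius (MvPolynomial (Fin m × Fin n) R) p e) =
        cokerAnn (powMatrix R (p ^ e) ι) := by
    rw [cokerAnn_powMatrix (pow_pos (Fact.out : p.Prime).pos e) ι hι, Matrix.minorsIdeal_map]
    congr 1
    ext1 i j
    simp [powMatrix, iterateFrobenius_def]
  rw [h₁]
  exact hasProjectiveDimensionLT_powMatrix (pow_pos (Fact.out : p.Prime).pos e) n m ι hι (by omega)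

theorem exists_iso_restrictScalars_of_smul_eq_zero (I : Ideal R) (M : ModuleCat.{u} R)
    (hM : ∀ r ∈ I, ∀ x : M, r • x = 0) : ∃ N : ModuleCat.{u} (R ⧸ I),
      Nonempty ((ModuleCat.restrictScalars (Ideal.Quotient.mk I)).obj N ≅ M) := by
  have h : Module.IsTorsionBySet R M I := fun x r => hM r r.2 x
  let _ := h.module
  let N := ModuleCat.of (R ⧸ I) M
  let e : (ModuleCat.restrictScalars (Ideal.Quotient.mk I)).obj N ≃ₗ[R] M :=
    { AddEquiv.refl M with map_smul' := fun r x => rfl }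
  exact ⟨N, ⟨e.toModuleIso⟩⟩

theorem LocalCohomologyVanishes.of_subsingleton (a : Ideal R) (i : ℕ) (M : ModuleCat.{u} R)
    [Subsingleton M] : LocalCohomologyVanishes a (i + 1) M := by
  have := (ModuleCat.isZero_of_subsingleton M).injective
  exact of_injective a i M

theorem localCohomologyVanishes_minorsIdeal_of_prime_smul (p : ℕ) [Fact p.Prime]
    [IsNoetherianRing R] (hmn : m ≤ n) (A : Matrix (Fin m) (Fin n) R) {i : ℕ}
    (hi : n - m + 1 < i) (M : ModuleCat.{u} R) (hM : ∀ x : M, (p : R) • x = 0) :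
    LocalCohomologyVanishes (A.minorsIdeal m) i M := by
  obtain ⟨i, rfl⟩ : ∃ j, i = j + 1 := ⟨i - 1, by omega⟩
  -- Otherwise `R / p` has characteristic `p` and `M` is a module over it; if `p` is invertible, `M`
  -- is zero.
  by_cases hp : IsUnit (p : R)
  · have h0 : ∀ x : M, x = 0 := fun x => by rw [← hp.smul_eq_zero, hM]
    have : Subsingleton M := ⟨fun x y => by rw [h0 x, h0 y]⟩
    exact LocalCohomologyVanishes.of_subsingleton _ _ _
  · have := CharP.quotient R p hp
    obtain ⟨N, ⟨e⟩⟩ := exists_iso_restrictScalars_of_smul_eq_zero (Ideal.span {(p : R)}) M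
      (fun r hr x => by
        obtain ⟨c, rfl⟩ := Ideal.mem_span_singleton'.1 hr
        rw [mul_smul, hM, smul_zero])
    refine LocalCohomologyVanishes.of_iso e ?_
    rw [localCohomologyVanishes_restrictScalars_iff_of_surjective _ Ideal.Quotient.mk_surjective,
      Matrix.minorsIdeal_map]
    exact localCohomologyVanishes_minorsIdeal_of_prime p hmn _ hi N

/-- The characteristic may be composite. For a prime `p` dividing `q`, the sequence `0 → ker p → M →
pM → 0` has ends killed by `p` and by `q / p`. -/
theorem localCohomologyVanishes_minorsIdeal [IsNoetherianRing R] (hmn : m ≤ n)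
    (A : Matrix (Fin m) (Fin n) R) {i : ℕ} (hi : n - m + 1 < i) (q : ℕ) :
    0 < q → ∀ M : ModuleCat.{u} R, (∀ x : M, (q : R) • x = 0) →
      LocalCohomologyVanishes (A.minorsIdeal m) i M := by
  obtain ⟨i, rfl⟩ : ∃ j, i = j + 1 := ⟨i - 1, by omega⟩
  induction q using induction_on_primes with
  | zero => exact fun h => absurd h (lt_irrefl 0)
  | one =>
    intro _ M hM
    have : Subsingleton M := ⟨fun x y => by
      rw [← one_smul R x, ← one_smul R y, ← Nat.cast_one, hM, hM]⟩
    exact LocalCohomologyVanishes.of_subsingleton _ _ _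
  | prime_mul p a hp ih =>
    intro h M hM
    have : Fact p.Prime := ⟨hp⟩
    have ha : 0 < a := Nat.pos_of_mul_pos_left h
    let f := LinearMap.lsmul R M (p : R)
    have hS := LinearMap.shortExact_shortComplexKer f.surjective_rangeRestrict
    refine LocalCohomologyVanishes.X₂ hS ?_ (ih ha _ ?_)
    · exact localCohomologyVanishes_minorsIdeal_of_prime_smul p hmn A hi _ fun x => by
        have h : (f.rangeRestrict x.1 : M) = 0 := congrArg Subtype.val (LinearMap.mem_ker.1 x.2)
        exact Subtype.ext h
    · rintro ⟨_, x, rfl⟩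
      apply Subtype.ext
      change (a : R) • (p : R) • x = 0
      rw [smul_smul, mul_comm, ← Nat.cast_mul, hM]

end UpperBound

/-! ### Local cohomology as a module: the direct limit of `Ext^i(R/a^t, M)` -/

section ExtColimit

variable {R : Type u} [CommRing R] (a : Ideal R) (i : ℕ) (M N : ModuleCat.{u} R)

/-- The transition maps of the directed system `Ext^i(R/a^t, M)`. -/
def extTransition (s t : ℕ) (h : s ≤ t) :
    Abelian.Ext (ModuleCat.of R (R ⧸ a ^ s)) M i →ₗ[R]
      Abelian.Ext (ModuleCat.of R (R ⧸ a ^ t)) M i :=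
  (Ext.mk₀ (quotientProj (Ideal.pow_le_pow_right h))).precompOfLinear R M (zero_add i)

theorem extTransition_apply {s t : ℕ} (h : s ≤ t)
    (x : Abelian.Ext (ModuleCat.of R (R ⧸ a ^ s)) M i) :
    extTransition a i M s t h x =
      (Ext.mk₀ (quotientProj (Ideal.pow_le_pow_right h))).comp x (zero_add i) := rfl

instance : DirectedSystem (fun t : ℕ => Abelian.Ext (ModuleCat.of R (R ⧸ a ^ t)) M i)
    (extTransition a i M · · ·) where
  map_self t x := by
    rw [extTransition_apply]
    have : quotientProj (Ideal.pow_le_pow_right (I := a) (le_refl t)) = 𝟙 _ := by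
      ext; rfl
    rw [this, Ext.mk₀_id_comp]
  map_map _ _ _ h h' x := by
    rw [extTransition_apply, extTransition_apply, extTransition_apply, Ext.mk₀_comp_mk₀_assoc,
      quotientProj_comp]

theorem smul_ext_quotient_eq_zero {K : Ideal R} {i : ℕ} {M : ModuleCat.{u} R} {r : R} (hr : r ∈ K)
    (x : Abelian.Ext (ModuleCat.of R (R ⧸ K)) M i) : r • x = 0 := by
  have h0 : r • 𝟙 (ModuleCat.of R (R ⧸ K)) = 0 := by
    apply quotient_hom_ext
    change (r • (Submodule.Quotient.mk 1 : R ⧸ K)) = 0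
    rw [← Submodule.Quotient.mk_smul, Submodule.Quotient.mk_eq_zero]
    simpa using hr
  rw [← Ext.mk₀_id_comp x, ← Ext.smul_comp, ← Ext.mk₀_smul, h0, Ext.mk₀_zero, Ext.zero_comp]

/-- The direct limit of the modules `Ext^i(R/a^t, M)`. -/
def ExtColimit : Type u :=
  Module.DirectLimit (fun t : ℕ => Abelian.Ext (ModuleCat.of R (R ⧸ a ^ t)) M i)
    (extTransition a i M)

namespace ExtColimit

instance : AddCommGroup (ExtColimit a i M) :=
  inferInstanceAs (AddCommGroup (Module.DirectLimit _ (extTransition a i M)))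

instance : Module R (ExtColimit a i M) :=
  inferInstanceAs (Module R (Module.DirectLimit _ (extTransition a i M)))

/-- The canonical map from a member of the system. -/
def of (t : ℕ) : Abelian.Ext (ModuleCat.of R (R ⧸ a ^ t)) M i →ₗ[R] ExtColimit a i M :=
  Module.DirectLimit.of R ℕ _ (extTransition a i M) t

variable {a i M N}

theorem exists_of (z : ExtColimit a i M) : ∃ t x, of a i M t x = z :=
  Module.DirectLimit.exists_of z

theorem of_transition {s t : ℕ} (h : s ≤ t)
    (x : Abelian.Ext (ModuleCat.of R (R ⧸ a ^ s)) M i) :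
    of a i M t ((Ext.mk₀ (quotientProj (Ideal.pow_le_pow_right h))).comp x (zero_add i)) =
      of a i M s x :=
  Module.DirectLimit.of_f (f := extTransition a i M) (hij := h)

theorem of_eq_zero_iff {t : ℕ} {x : Abelian.Ext (ModuleCat.of R (R ⧸ a ^ t)) M i} :
    of a i M t x = 0 ↔ ∃ (s : ℕ) (h : t ≤ s),
      (Ext.mk₀ (quotientProj (Ideal.pow_le_pow_right h))).comp x (zero_add i) = 0 := by
  constructor
  · intro h
    obtain ⟨s, hs, h0⟩ := Module.DirectLimit.of.zero_exact (f := extTransition a i M) h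
    exact ⟨s, hs, h0⟩
  · rintro ⟨s, hs, h0⟩
    rw [← of_transition hs, h0, map_zero]

theorem subsingleton_iff : Subsingleton (ExtColimit a i M) ↔ LocalCohomologyVanishes a i M := by
  constructor
  · intro _ t x
    exact of_eq_zero_iff.1 (Subsingleton.elim (of a i M t x) 0)
  · intro h
    refine subsingleton_of_forall_eq 0 fun z => ?_
    obtain ⟨t, x, rfl⟩ := exists_of z
    exact of_eq_zero_iff.2 (h t x)

variable (a i) in
/-- Functoriality of the direct limit. -/
def map (f : M ⟶ N) : ExtColimit a i M →ₗ[R] ExtColimit a i N :=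
  Module.DirectLimit.map (fun t => (Ext.mk₀ f).postcompOfLinear R _ (add_zero i))
    (fun s t h => by
      ext x
      exact Ext.comp_assoc_of_third_deg_zero _ _ _ (zero_add i))

theorem map_of (f : M ⟶ N) {t : ℕ} (x : Abelian.Ext (ModuleCat.of R (R ⧸ a ^ t)) M i) :
    map a i f (of a i M t x) = of a i N t (x.comp (Ext.mk₀ f) (add_zero i)) :=
  Module.DirectLimit.map_apply_of _ _ _

theorem map_comp {L : ModuleCat.{u} R} (f : M ⟶ N) (g : N ⟶ L) (z : ExtColimit a i M) :
    map a i (f ≫ g) z = map a i g (map a i f z) := by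
  obtain ⟨t, x, rfl⟩ := exists_of z
  rw [map_of, map_of, map_of]
  simp

theorem map_smul_id (r : R) (z : ExtColimit a i M) : map a i (r • 𝟙 M) z = r • z := by
  obtain ⟨t, x, rfl⟩ := exists_of z
  rw [map_of, ← Ext.smul_eq_comp_mk₀, map_smul]

theorem map_smul_hom (f : M ⟶ N) (r : R) (z : ExtColimit a i M) :
    map a i (r • f) z = r • map a i f z := by
  obtain ⟨t, x, rfl⟩ := exists_of z
  rw [map_of, map_of, Ext.mk₀_smul, Ext.comp_smul, map_smul]

theorem map_add_hom (f g : M ⟶ N) (z : ExtColimit a i M) :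
    map a i (f + g) z = map a i f z + map a i g z := by
  obtain ⟨t, x, rfl⟩ := exists_of z
  rw [map_of, map_of, map_of, Ext.mk₀_add, Ext.comp_add, map_add]

theorem map_zero_hom (z : ExtColimit a i M) : map a i (0 : M ⟶ N) z = 0 := by
  obtain ⟨t, x, rfl⟩ := exists_of z
  rw [map_of, Ext.mk₀_zero, Ext.comp_zero, map_zero]

theorem map_sum_hom {ι : Type*} (s : Finset ι) (f : ι → (M ⟶ N)) (z : ExtColimit a i M) :
    map a i (∑ j ∈ s, f j) z = ∑ j ∈ s, map a i (f j) z := by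
  classical
  induction s using Finset.induction_on with
  | empty => simp [map_zero_hom]
  | insert j s hj ih => rw [Finset.sum_insert hj, Finset.sum_insert hj, map_add_hom, ih]

/-- Every element is killed by some power of each element of the ideal. -/
theorem exists_pow_smul_eq_zero {r : R} (hr : r ∈ a) (z : ExtColimit a i M) :
    ∃ t : ℕ, r ^ t • z = 0 := by
  obtain ⟨t, x, rfl⟩ := exists_of z
  refine ⟨t, ?_⟩
  rw [← map_smul, smul_ext_quotient_eq_zero (Ideal.pow_mem_pow hr t), map_zero]

variable {S : ShortComplex (ModuleCat.{u} R)} (hS : S.ShortExact)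

variable (a i) in
/-- The connecting map. -/
def δ : ExtColimit a i S.X₃ →ₗ[R] ExtColimit a (i + 1) S.X₁ :=
  Module.DirectLimit.map (fun t => hS.extClass.postcompOfLinear R _ rfl)
    (fun s t h => by
      ext x
      exact Ext.comp_assoc _ _ _ (zero_add i) rfl (by lia))

theorem δ_of {t : ℕ} (x : Abelian.Ext (ModuleCat.of R (R ⧸ a ^ t)) S.X₃ i) :
    δ a i hS (of a i S.X₃ t x) = of a (i + 1) S.X₁ t (x.comp hS.extClass rfl) :=
  Module.DirectLimit.map_apply_of _ _ _

include hS

theorem exact₂ (z : ExtColimit a i S.X₂) (hz : map a i S.g z = 0) :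
    ∃ w, map a i S.f w = z := by
  obtain ⟨t, x, rfl⟩ := exists_of z
  rw [map_of] at hz
  obtain ⟨s, hs, h0⟩ := of_eq_zero_iff.1 hz
  rw [← Ext.comp_assoc_of_third_deg_zero] at h0
  obtain ⟨y, hy⟩ := Ext.covariant_sequence_exact₂ _ hS _ h0
  exact ⟨of a i S.X₁ s y, by rw [map_of, hy, of_transition hs]⟩

theorem exact₁ (z : ExtColimit a (i + 1) S.X₁) (hz : map a (i + 1) S.f z = 0) :
    ∃ w, δ a i hS w = z := by
  obtain ⟨t, x, rfl⟩ := exists_of z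
  rw [map_of] at hz
  obtain ⟨s, hs, h0⟩ := of_eq_zero_iff.1 hz
  rw [← Ext.comp_assoc_of_third_deg_zero] at h0
  obtain ⟨y, hy⟩ := Ext.covariant_sequence_exact₁ _ hS _ h0 rfl
  exact ⟨of a i S.X₃ s y, by rw [δ_of, hy, of_transition hs]⟩

theorem exact₃ (z : ExtColimit a i S.X₃) (hz : δ a i hS z = 0) :
    ∃ w, map a i S.g w = z := by
  obtain ⟨t, x, rfl⟩ := exists_of z
  rw [δ_of] at hz
  obtain ⟨s, hs, h0⟩ := of_eq_zero_iff.1 hz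
  rw [← Ext.comp_assoc _ _ _ (zero_add i) rfl (by lia)] at h0
  obtain ⟨y, hy⟩ := Ext.covariant_sequence_exact₃ _ hS _ rfl h0
  exact ⟨of a i S.X₂ s y, by rw [map_of, hy, of_transition hs]⟩

theorem map_surjective (h : LocalCohomologyVanishes a (i + 1) S.X₁) :
    Function.Surjective (map a i S.g) := fun z =>
  exact₃ hS z (subsingleton_iff.2 h |>.elim _ _)

end ExtColimit

end ExtColimit

/-! ### Artinian modules and secondary decomposition -/

section Artinian

variable {R : Type*} [CommRing R] {H : Type*} [AddCommGroup H] [Module R H]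

/-- A module all of whose elements are killed by powers of `x` is Artinian if the kernel of `x`
is. -/
theorem isArtinian_of_isArtinian_ker (x : R) (htor : ∀ h : H, ∃ t : ℕ, x ^ t • h = 0)
    [IsArtinian R (LinearMap.ker (LinearMap.lsmul R H x))] : IsArtinian R H := by
  rw [← monotone_stabilizes_iff_artinian]
  intro N
  set K := LinearMap.ker (LinearMap.lsmul R H x) with hK
  -- `N' j k` is `x^k N_j ∩ ker x`, decreasing in both indices.
  let N' (j k : ℕ) : Submodule R K :=
    Submodule.comap K.subtype (Submodule.map (LinearMap.lsmul R H (x ^ k)) (N j))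
  have hN' : ∀ {j j' k k'}, j ≤ j' → k ≤ k' → N' j' k' ≤ N' j k := by
    rintro j j' k k' hj hk y ⟨z, hz, hzy⟩
    refine ⟨x ^ (k' - k) • z, Submodule.smul_mem _ _ (N.monotone hj hz), ?_⟩
    rw [← hzy, LinearMap.lsmul_apply, LinearMap.lsmul_apply, smul_smul, ← pow_add,
      Nat.add_sub_cancel' hk]
  obtain ⟨_, ⟨⟨j₀, k₀⟩, rfl⟩, hmin⟩ := IsArtinian.set_has_minimal
    (Set.range fun q : ℕ × ℕ => N' q.1 q.2) ⟨_, ⟨(0, 0), rfl⟩⟩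
  have hstab : ∀ j k, j₀ ≤ j → k₀ ≤ k → N' j k = N' j₀ k₀ := fun j k hj hk => by
    by_contra hne
    exact hmin _ ⟨(j, k), rfl⟩ (lt_of_le_of_ne (hN' hj hk) hne)
  have hfix : ∀ k, ∃ j₁, ∀ j, j₁ ≤ j → N' j₁ k = N' j k := fun k => by
    obtain ⟨n, hn⟩ := IsArtinian.monotone_stabilizes (R := R) (M := K)
      ⟨fun j => OrderDual.toDual (N' j k), fun j j' hj => hN' hj le_rfl⟩
    exact ⟨n, fun j hj => hn j hj⟩
  choose J hJ using hfix
  -- A minimal `N' j₀ k₀` controls all `k ≥ k₀` at once; the finitely many smaller `k` are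
  -- stabilised separately.
  let n := max j₀ ((Finset.range k₀).sup J)
  have hn : ∀ k j, n ≤ j → N' n k = N' j k := by
    intro k j hj
    by_cases hk : k < k₀
    · have hJn : J k ≤ n := (Finset.le_sup (Finset.mem_range.2 hk)).trans (le_max_right _ _)
      rw [← hJ k n hJn, hJ k j (hJn.trans hj)]
    · rw [hstab n k (le_max_left _ _) (not_lt.1 hk),
        hstab j k ((le_max_left _ _).trans hj) (not_lt.1 hk)]
  -- If `x^(t+1) h = 0`, stability at level `t` gives `h' ∈ N j` with `x^t h' = x^t h`, and `h - h'`
  -- is killed by `x^t`.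
  have key : ∀ j, n ≤ j → ∀ (t : ℕ) (h : H), x ^ t • h = 0 →
      h ∈ OrderDual.ofDual (N n) → h ∈ OrderDual.ofDual (N j) := by
    intro j hj t
    induction t with
    | zero =>
      intro h hh _
      rw [pow_zero, one_smul] at hh
      rw [hh]
      exact Submodule.zero_mem _
    | succ t ih =>
      intro h hh hmem
      have hk : x ^ t • h ∈ K := by
        rw [hK, LinearMap.mem_ker, LinearMap.lsmul_apply, smul_smul, ← pow_succ', hh]
      have h1 : (⟨x ^ t • h, hk⟩ : K) ∈ N' n t := ⟨h, hmem, rfl⟩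
      rw [hn t j hj] at h1
      obtain ⟨h', hh', e⟩ := h1
      have e' : x ^ t • h' = x ^ t • h := e
      have h2 := ih (h - h') (by rw [smul_sub, e', sub_self])
        (Submodule.sub_mem _ hmem (N.monotone hj hh'))
      simpa using Submodule.add_mem _ h2 hh'
  refine ⟨n, fun j hj => le_antisymm (N.monotone hj) fun h hh => ?_⟩
  obtain ⟨t, ht⟩ := htor h
  exact key j hj t h ht hh

theorem maximalIdeal_quotient [IsLocalRing R] (I : Ideal R) [IsLocalRing (R ⧸ I)] :
    (IsLocalRing.maximalIdeal R).map (Ideal.Quotient.mk I) = IsLocalRing.maximalIdeal (R ⧸ I) := by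
  rw [← IsLocalRing.eq_maximalIdeal (Ideal.comap_isMaximal_of_surjective (Ideal.Quotient.mk I)
    Ideal.Quotient.mk_surjective (K := IsLocalRing.maximalIdeal (R ⧸ I))),
    Ideal.map_comap_of_surjective _ Ideal.Quotient.mk_surjective]

/-- A finitely generated module over a Noetherian local ring killed by a power of the maximal ideal
is Artinian. -/
theorem isArtinian_of_maximalIdeal_pow_smul [IsNoetherianRing R] [IsLocalRing R]
    [Module.Finite R H] (t : ℕ) (h : ∀ r ∈ IsLocalRing.maximalIdeal R ^ t, ∀ x : H, r • x = 0) :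
    IsArtinian R H := by
  set I := IsLocalRing.maximalIdeal R ^ t with hI
  rcases subsingleton_or_nontrivial (R ⧸ I) with hs | hs
  · have : Subsingleton H := subsingleton_of_forall_eq 0 fun x => by
      have h1 : (1 : R) ∈ I := by
        rw [Ideal.Quotient.subsingleton_iff.1 hs]
        trivial
      rw [← one_smul R x, h 1 h1]
    infer_instance
  have : IsLocalRing (R ⧸ I) :=
    IsLocalRing.of_surjective' (Ideal.Quotient.mk I) Ideal.Quotient.mk_surjective
  have hart : IsArtinianRing (R ⧸ I) := by
    rw [isArtinianRing_iff_isNilpotent_maximalIdeal]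
    refine ⟨t, ?_⟩
    rw [← maximalIdeal_quotient, ← Ideal.map_pow, ← hI, Ideal.map_quotient_self]
    rfl
  have hM : Module.IsTorsionBySet R H I := fun x r => h r r.2 x
  let _ := hM.module
  have : Module.Finite (R ⧸ I) H := Module.Finite.of_restrictScalars_finite R (R ⧸ I) H
  exact (hM.semilinearMap.isArtinian_iff_of_bijective Function.bijective_id).2
    (isArtinian_of_fg_of_artinian' (R := R ⧸ I) (M := H))

/-- A nonzero Artinian module which is not the sum of two proper submodules is secondary. -/
theorem isPrime_radical_annihilator_of_supIrred [IsArtinian R H] [Nontrivial H]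
    (h : ∀ A B : Submodule R H, A ⊔ B = ⊤ → A = ⊤ ∨ B = ⊤) :
    (Module.annihilator R H).radical.IsPrime ∧
      ∀ x ∉ (Module.annihilator R H).radical, Function.Surjective (LinearMap.lsmul R H x) := by
  have key : ∀ x ∉ (Module.annihilator R H).radical,
      Function.Surjective (LinearMap.lsmul R H x) := by
    intro x hx
    -- Fitting: `ker x^n + im x^n` is everything for large `n`, so `x` acts either nilpotently or
    -- surjectively.
    obtain ⟨n, hn⟩ := ((LinearMap.eventually_codisjoint_ker_pow_range_pow
      (LinearMap.lsmul R H x)).and (Filter.eventually_ge_atTop 1)).exists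
    have hpow : ∀ y, ((LinearMap.lsmul R H x) ^ n) y = x ^ n • y := fun y => by
      change ((Module.toModuleEnd R H x) ^ n) y = _
      rw [← map_pow]
      rfl
    rcases h _ _ hn.1.eq_top with h1 | h1
    · refine absurd ⟨n, Module.mem_annihilator.2 fun y => ?_⟩ hx
      rw [← hpow, ← LinearMap.mem_ker, h1]
      trivial
    · intro y
      obtain ⟨z, hz⟩ := LinearMap.range_eq_top.1 h1 y
      refine ⟨x ^ (n - 1) • z, ?_⟩
      rw [LinearMap.lsmul_apply, smul_smul, ← pow_succ', Nat.sub_add_cancel hn.2, ← hpow, hz]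
  refine ⟨⟨?_, ?_⟩, key⟩
  · rw [Ne, Ideal.radical_eq_top, Ideal.eq_top_iff_one, Module.mem_annihilator]
    intro h1
    obtain ⟨y, hy⟩ := exists_ne (0 : H)
    exact hy (by rw [← one_smul R y, h1])
  · intro x y hxy
    by_contra hcon
    rw [not_or] at hcon
    obtain ⟨n, hn⟩ := hxy
    have hs : ∀ (n : ℕ) (z : H), ∃ w, x ^ n • w = z := by
      intro n
      induction n with
      | zero => exact fun z => ⟨z, by simp⟩
      | succ n ih =>
        intro z
        obtain ⟨y, rfl⟩ := key x hcon.1 z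
        obtain ⟨w, rfl⟩ := ih y
        exact ⟨w, by rw [pow_succ', mul_smul]; rfl⟩
    refine hcon.2 ⟨n, Module.mem_annihilator.2 fun z => ?_⟩
    obtain ⟨w, rfl⟩ := hs n z
    rw [smul_smul, mul_comm, ← mul_pow]
    exact Module.mem_annihilator.1 hn w

/-- Every Artinian module is, up to a part killed by a power of the maximal ideal, divisible by all
elements outside finitely many non-maximal primes. -/
theorem exists_divisible_part [IsNoetherianRing R] [IsLocalRing R] [IsArtinian R H]
    (N : Submodule R H) :
    ∃ (A : Submodule R H) (F : Finset (Ideal R)) (t : ℕ), A ≤ N ∧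
      (∀ P ∈ F, P.IsPrime ∧ P ≠ IsLocalRing.maximalIdeal R) ∧
      (∀ x, (∀ P ∈ F, x ∉ P) → A ≤ A.map (LinearMap.lsmul R H x)) ∧
      IsLocalRing.maximalIdeal R ^ t • N ≤ A := by
  classical
  induction N using WellFoundedLT.induction with
  | ind N ih =>
  by_cases hN : ∃ B C : Submodule R H, B < N ∧ C < N ∧ B ⊔ C = N
  · obtain ⟨B, C, hB, hC, rfl⟩ := hN
    obtain ⟨A₁, F₁, t₁, hA₁, hF₁, hd₁, ht₁⟩ := ih B hB
    obtain ⟨A₂, F₂, t₂, hA₂, hF₂, hd₂, ht₂⟩ := ih C hC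
    refine ⟨A₁ ⊔ A₂, F₁ ∪ F₂, max t₁ t₂, sup_le_sup hA₁ hA₂, ?_, ?_, ?_⟩
    · intro P hP
      rcases Finset.mem_union.1 hP with h | h
      exacts [hF₁ P h, hF₂ P h]
    · intro x hx
      rw [Submodule.map_sup]
      exact sup_le_sup (hd₁ x fun P hP => hx P (Finset.mem_union_left _ hP))
        (hd₂ x fun P hP => hx P (Finset.mem_union_right _ hP))
    · rw [Submodule.smul_sup]
      exact sup_le_sup
        ((Submodule.smul_mono_left (Ideal.pow_le_pow_right (le_max_left _ _))).trans ht₁)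
        ((Submodule.smul_mono_left (Ideal.pow_le_pow_right (le_max_right _ _))).trans ht₂)
  · rcases subsingleton_or_nontrivial N with hs | hs
    · refine ⟨⊥, ∅, 0, bot_le, by simp, fun x _ => bot_le, ?_⟩
      rw [Submodule.eq_bot_of_subsingleton (p := N), Submodule.smul_bot]
    obtain ⟨hP, hd⟩ := isPrime_radical_annihilator_of_supIrred (R := R) (H := N) (by
      intro A B hAB
      by_contra hcon
      rw [not_or] at hcon
      have hlt : ∀ A : Submodule R N, A ≠ ⊤ → A.map N.subtype < N := fun A hA => by
        refine lt_of_le_of_ne (Submodule.map_subtype_le N A) fun h => hA ?_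
        exact Submodule.map_injective_of_injective N.injective_subtype
          (h.trans (Submodule.map_subtype_top N).symm)
      refine hN ⟨_, _, hlt A hcon.1, hlt B hcon.2, ?_⟩
      rw [← Submodule.map_sup, hAB, Submodule.map_subtype_top])
    -- A secondary `N` attached to the maximal ideal is killed by a power of it and contributes
    -- nothing; otherwise `N` is divisible by everything outside its prime.
    by_cases hm : (Module.annihilator R N).radical = IsLocalRing.maximalIdeal R
    · obtain ⟨t, ht⟩ := Ideal.exists_pow_le_of_le_radical_of_fg hm.ge
        (IsNoetherian.noetherian (IsLocalRing.maximalIdeal R))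
      refine ⟨⊥, ∅, t, bot_le, by simp, fun x _ => bot_le, ?_⟩
      refine Submodule.smul_le.2 fun r hr y hy => ?_
      have := Module.mem_annihilator.1 (ht hr) ⟨y, hy⟩
      exact congrArg Subtype.val this
    · refine ⟨N, {(Module.annihilator R N).radical}, 0, le_rfl, ?_, ?_, Submodule.smul_le_right⟩
      · intro P h
        rw [Finset.mem_singleton] at h
        subst h
        exact ⟨hP, hm⟩
      · intro x hx y hy
        obtain ⟨z, hz⟩ := hd x (hx _ (Finset.mem_singleton_self _)) ⟨y, hy⟩
        exact ⟨z, z.2, congrArg Subtype.val hz⟩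

/-- The hypothesis makes the divisible part all of `H`; prime avoidance yields `x ∈ 𝔪` outside the
finitely many non-maximal primes. -/
theorem exists_mem_maximalIdeal_smul_surjective [IsNoetherianRing R] [IsLocalRing R]
    [IsArtinian R H] (h : IsLocalRing.maximalIdeal R • (⊤ : Submodule R H) = ⊤) :
    ∃ x ∈ IsLocalRing.maximalIdeal R, ∀ y : H, ∃ z, x • z = y := by
  obtain ⟨A, F, t, -, hF, hd, ht⟩ := exists_divisible_part (⊤ : Submodule R H)
  have htop : ∀ t : ℕ, IsLocalRing.maximalIdeal R ^ t • (⊤ : Submodule R H) = ⊤ := fun t => by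
    induction t with
    | zero => rw [pow_zero, Ideal.one_eq_top, Submodule.top_smul]
    | succ t ih => rw [pow_succ, Submodule.mul_smul, h, ih]
  rw [htop, top_le_iff] at ht
  subst ht
  have hx : ¬ ((IsLocalRing.maximalIdeal R : Set R) ⊆ ⋃ P ∈ (F : Set (Ideal R)), (P : Set R)) := by
    rw [Ideal.subset_union_prime (f := fun P => P) ⊥ ⊥ fun P hP _ _ => (hF P hP).1]
    rintro ⟨P, hP, hle⟩
    exact (hF P hP).2 ((IsLocalRing.maximalIdeal.isMaximal R).eq_of_le (hF P hP).1.ne_top hle).symm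
  obtain ⟨x, hxm, hxF⟩ := Set.not_subset.1 hx
  refine ⟨x, hxm, fun y => ?_⟩
  obtain ⟨z, -, hz⟩ := hd x (fun P hP hxP => hxF (Set.mem_biUnion hP hxP))
    (Submodule.mem_top (x := y))
  exact ⟨z, hz⟩

end Artinian

/-! ### Local cohomology of finite modules at the maximal ideal is Artinian -/

section LocalArtinian

theorem LinearMap.isArtinian_range {R M N : Type*} [Ring R] [AddCommGroup M] [Module R M]
    [AddCommGroup N] [Module R N] [IsArtinian R M] (f : M →ₗ[R] N) :
    IsArtinian R (LinearMap.range f) :=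
  isArtinian_of_surjective _ f.rangeRestrict f.surjective_rangeRestrict

variable {R : Type u} [CommRing R]

/-- The kernel of `x` on the higher module is a quotient of the Artinian one through the connecting
map, and every element is killed by a power of `x`. -/
theorem isArtinian_extColimit_of_smul {a : Ideal R} {i : ℕ} {x : R} (hx : x ∈ a)
    {M N : ModuleCat.{u} R} {g : M ⟶ N} (w : (x • 𝟙 M) ≫ g = 0)
    (hS : (ShortComplex.mk (x • 𝟙 M) g w).ShortExact) [h : IsArtinian R (ExtColimit a i N)] :
    IsArtinian R (ExtColimit a (i + 1) M) := by
  let S := ShortComplex.mk (x • 𝟙 M) g w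
  let d : ExtColimit a i N →ₗ[R] ExtColimit a (i + 1) M := ExtColimit.δ (S := S) a i hS
  have hd : IsArtinian R (LinearMap.range d) := LinearMap.isArtinian_range d
  have hle : LinearMap.ker (LinearMap.lsmul R (ExtColimit a (i + 1) M) x) ≤ LinearMap.range d :=
    fun z hz => ExtColimit.exact₁ (S := S) hS z ((ExtColimit.map_smul_id x z).trans hz)
  have := isArtinian_of_le hle
  exact isArtinian_of_isArtinian_ker x fun z => ExtColimit.exists_pow_smul_eq_zero hx z

variable [IsNoetherianRing R]

theorem Ideal.gammaTorsion_quotient_gammaTorsion (a : Ideal R) (M : Type*) [AddCommGroup M]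
    [Module R M] : a.gammaTorsion (M ⧸ a.gammaTorsion M) = ⊥ := by
  refine eq_bot_iff.2 fun y hy => ?_
  obtain ⟨x, rfl⟩ := Submodule.mkQ_surjective _ y
  obtain ⟨t, ht⟩ := hy
  obtain ⟨s, hs⟩ := a.exists_pow_smul_eq_zero_of_fg
    ((LinearMap.toSpanSingleton R M x) ∘ₗ (a ^ t).subtype) (fun w => by
      have := ht w w.2
      rwa [← map_smul, Submodule.mkQ_apply, Submodule.Quotient.mk_eq_zero] at this)
  rw [Submodule.mem_bot, Submodule.mkQ_apply, Submodule.Quotient.mk_eq_zero]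
  refine ⟨s + t, fun r hr => ?_⟩
  have hle : a ^ (s + t) ≤ LinearMap.ker (LinearMap.toSpanSingleton R M x) := by
    rw [pow_add]
    refine Ideal.mul_le.2 fun u hu v hv => ?_
    rw [LinearMap.mem_ker, LinearMap.toSpanSingleton_apply, mul_smul]
    exact hs u hu ⟨v, hv⟩
  exact hle hr

variable [IsLocalRing R]

open IsLocalRing

theorem exists_mem_maximalIdeal_isSMulRegular (M : Type*) [AddCommGroup M] [Module R M]
    [Module.Finite R M] (hM : (maximalIdeal R).gammaTorsion M = ⊥) :
    ∃ x ∈ maximalIdeal R, IsSMulRegular M x := by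
  by_contra! hcon
  have h1 : (maximalIdeal R : Set R) ⊆ ⋃ P ∈ associatedPrimes R M, (P : Set R) := by
    rw [biUnion_associatedPrimes_eq_compl_regular]
    exact fun x hx => hcon x hx
  obtain ⟨P, hP, hle⟩ := (Ideal.subset_union_prime_finite (associatedPrimes.finite R M)
    (f := fun P => P) ⊥ ⊥ fun P hP _ _ => hP.1).1 h1
  obtain ⟨hprime, y, hy⟩ := (Submodule.isAssociatedPrime_iff).1 hP
  have hy0 : y ∈ (maximalIdeal R).gammaTorsion M := ⟨1, fun r hr => by
    rw [pow_one] at hr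
    have := hle hr
    rw [hy, Submodule.mem_colon_singleton] at this
    exact this⟩
  rw [hM, Submodule.mem_bot] at hy0
  apply hprime.ne_top
  rw [hy, hy0, Ideal.eq_top_iff_one, Submodule.mem_colon_singleton, smul_zero]
  exact Submodule.zero_mem _

/-- `Γ(M)` is finitely generated, so a single stage `Hom(R/𝔪^t, M)` already surjects onto the limit.
-/
theorem isArtinian_extColimit_zero (M : ModuleCat.{u} R) [Module.Finite R M] :
    IsArtinian R (ExtColimit (maximalIdeal R) 0 M) := by
  obtain ⟨t, ht⟩ := (maximalIdeal R).exists_pow_smul_eq_zero_of_fg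
    ((maximalIdeal R).gammaTorsion M).subtype (fun w => w.2)
  have : Module.Finite R (ModuleCat.of R (R ⧸ maximalIdeal R ^ t)) :=
    inferInstanceAs (Module.Finite R (R ⧸ maximalIdeal R ^ t))
  have : IsArtinian R (Abelian.Ext (ModuleCat.of R (R ⧸ maximalIdeal R ^ t)) M 0) :=
    isArtinian_of_maximalIdeal_pow_smul t fun r hr x => smul_ext_quotient_eq_zero hr x
  refine isArtinian_of_surjective _ (ExtColimit.of (maximalIdeal R) 0 M t) fun z => ?_
  obtain ⟨s, x, rfl⟩ := ExtColimit.exists_of z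
  obtain ⟨f, rfl⟩ := (Ext.mk₀_bijective _ _).2 x
  let y := f.hom (Submodule.Quotient.mk 1)
  have hy : y ∈ (maximalIdeal R).gammaTorsion M := ⟨s, smul_quotient_hom_one f⟩
  let g := quotientToModule (K := maximalIdeal R ^ t) y (fun r hr => ht r hr ⟨y, hy⟩)
  refine ⟨Ext.mk₀ g, ?_⟩
  rw [← ExtColimit.of_transition (le_max_left t s), ← ExtColimit.of_transition (le_max_right t s),
    Ext.mk₀_comp_mk₀, Ext.mk₀_comp_mk₀]
  congr 2
  apply quotient_hom_ext
  exact quotientToModule_one (K := maximalIdeal R ^ t) y fun r hr => ht r hr ⟨y, hy⟩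

/-- In positive degree the cohomology of `M` embeds in that of `M / Γ(M)`, which has a regular
element `x ∈ 𝔪`; the induction hypothesis applies to the quotient by `x`. -/
theorem isArtinian_extColimit (i : ℕ) : ∀ (M : ModuleCat.{u} R) [Module.Finite R M],
    IsArtinian R (ExtColimit (maximalIdeal R) i M) := by
  induction i with
  | zero => exact fun M _ => isArtinian_extColimit_zero M
  | succ i ih =>
    intro M _
    set Γ := (maximalIdeal R).gammaTorsion M with hΓ
    have hS := LinearMap.shortExact_shortComplexKer Γ.mkQ_surjective
    have hX₁ : LocalCohomologyVanishes (maximalIdeal R) (i + 1) Γ.mkQ.shortComplexKer.X₁ := by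
      refine LocalCohomologyVanishes.of_gammaTorsion_eq_top _ _ _ (eq_top_iff.2 fun y _ => ?_)
      have hy : y.1 ∈ Γ := by
        have := LinearMap.mem_ker.1 y.2
        rwa [Submodule.mkQ_apply, Submodule.Quotient.mk_eq_zero] at this
      obtain ⟨t, ht⟩ := hy
      exact ⟨t, fun r hr => Subtype.ext (ht r hr)⟩
    have hinj : Function.Injective
        (ExtColimit.map (maximalIdeal R) (i + 1) Γ.mkQ.shortComplexKer.g) := by
      rw [injective_iff_map_eq_zero]
      intro z hz
      obtain ⟨w, rfl⟩ := ExtColimit.exact₂ hS z hz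
      have := ExtColimit.subsingleton_iff.2 hX₁
      rw [Subsingleton.elim w 0, map_zero]
    obtain ⟨x, hx, hreg⟩ := exists_mem_maximalIdeal_isSMulRegular (M ⧸ Γ)
      ((maximalIdeal R).gammaTorsion_quotient_gammaTorsion M)
    let M' := ModuleCat.of R (M ⧸ Γ)
    have : Mono (x • 𝟙 M') := (ModuleCat.mono_iff_injective _).2 hreg
    have hS' := shortExact_cokernelShortComplex (x • 𝟙 M')
    have : Module.Finite R (M ⧸ Γ) := Module.Finite.of_surjective Γ.mkQ Γ.mkQ_surjective
    have : Module.Finite R (cokernelShortComplex (x • 𝟙 M')).X₂ :=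
      inferInstanceAs (Module.Finite R (M ⧸ Γ))
    have : Module.Finite R (cokernelShortComplex (x • 𝟙 M')).X₃ :=
      Module.Finite.of_surjective (cokernelShortComplex (x • 𝟙 M')).g.hom
        hS'.moduleCat_surjective_g
    have := isArtinian_extColimit_of_smul (i := i) (h := ih (cokernelShortComplex (x • 𝟙 M')).X₃)
      hx _ hS'
    exact isArtinian_of_injective _ hinj

end LocalArtinian

/-! ### Top local cohomology and passage to a hypersurface -/

section NonVanishing

open IsLocalRing

theorem LocalCohomologyVanishes.pi_fin {R : Type u} [CommRing R] {a : Ideal R} {i : ℕ}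
    (h : LocalCohomologyVanishes a i (ModuleCat.of R R)) (n : ℕ) :
    LocalCohomologyVanishes a i (ModuleCat.of R (Fin n → R)) := by
  rw [← ExtColimit.subsingleton_iff] at h ⊢
  refine subsingleton_of_forall_eq 0 fun z => ?_
  let p (j : Fin n) : ModuleCat.of R (Fin n → R) ⟶ ModuleCat.of R R :=
    ModuleCat.ofHom (LinearMap.proj j)
  let ι (j : Fin n) : ModuleCat.of R R ⟶ ModuleCat.of R (Fin n → R) :=
    ModuleCat.ofHom (LinearMap.single R (fun _ => R) j)
  have hsum : ∑ j, p j ≫ ι j = (1 : R) • 𝟙 _ := by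
    apply ModuleCat.hom_ext
    apply LinearMap.ext
    intro v
    rw [ModuleCat.hom_sum, LinearMap.sum_apply, one_smul]
    change ∑ j, Pi.single j (v j) = v
    exact Finset.univ_sum_single v
  rw [← one_smul R z, ← ExtColimit.map_smul_id, ← hsum, ExtColimit.map_sum_hom]
  refine Finset.sum_eq_zero fun j _ => ?_
  rw [ExtColimit.map_comp, Subsingleton.elim (ExtColimit.map a i (p j) z) 0, map_zero]

theorem LocalCohomologyVanishes.of_finite {R : Type u} [CommRing R] [IsNoetherianRing R]
    {a : Ideal R} {i : ℕ} (h : LocalCohomologyVanishes a i (ModuleCat.of R R))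
    (h' : ∀ (K : ModuleCat.{u} R) [Module.Finite R K], LocalCohomologyVanishes a (i + 1) K)
    (N : ModuleCat.{u} R) [Module.Finite R N] : LocalCohomologyVanishes a i N := by
  obtain ⟨n, f, hf⟩ := Module.Finite.exists_fin' R N
  have : Module.Finite R f.shortComplexKer.X₁ := inferInstanceAs (Module.Finite R (LinearMap.ker f))
  exact LocalCohomologyVanishes.X₃ (LinearMap.shortExact_shortComplexKer hf) (h' _) (h.pi_fin n)

/-- In the top degree `H^c(R) → H^c(R/x)` is onto; every element of the source is a multiple of `x`,
and `x` acts as zero on the target. -/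
theorem vanishes_quotient_of_smul_surjective {R : Type u} [CommRing R] [IsNoetherianRing R]
    {a : Ideal R} {c : ℕ}
    (h : ∀ (N : ModuleCat.{u} R) [Module.Finite R N], LocalCohomologyVanishes a (c + 1) N)
    {x : R} (hx : ∀ y : ExtColimit a c (ModuleCat.of R R), ∃ z, x • z = y) :
    LocalCohomologyVanishes a c (ModuleCat.of R (R ⧸ Ideal.span {x})) := by
  rw [← ExtColimit.subsingleton_iff]
  refine subsingleton_of_forall_eq 0 fun z => ?_
  let π : R →ₗ[R] R ⧸ Ideal.span {x} := (Ideal.span {x}).mkQ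
  have hS := LinearMap.shortExact_shortComplexKer (f := π) (Submodule.mkQ_surjective _)
  have : Module.Finite R π.shortComplexKer.X₁ := inferInstanceAs (Module.Finite R (LinearMap.ker π))
  obtain ⟨y, rfl⟩ := ExtColimit.map_surjective hS (h _) z
  obtain ⟨w, rfl⟩ := hx y
  rw [map_smul, ← ExtColimit.map_smul_hom]
  have h0 : x • π.shortComplexKer.g = 0 := by
    apply ModuleCat.hom_ext
    apply LinearMap.ext
    intro r
    change x • (Submodule.Quotient.mk r : R ⧸ Ideal.span {x}) = 0
    rw [← Submodule.Quotient.mk_smul, Submodule.Quotient.mk_eq_zero]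
    exact Ideal.mul_mem_right _ _ (Ideal.mem_span_singleton_self x)
  rw [h0, ExtColimit.map_zero_hom]

theorem finite_restrictScalars_of_surjective {R T : Type u} [CommRing R] [CommRing T] (φ : R →+* T)
    (hφ : Function.Surjective φ) (N : ModuleCat.{u} T) [Module.Finite T N] :
    Module.Finite R ((ModuleCat.restrictScalars φ).obj N) := by
  let _ := φ.toAlgebra
  have : Module.Finite R T := Module.Finite.of_surjective (Algebra.linearMap R T) hφ
  let _ : Module R N := Module.compHom N φ
  have : IsScalarTower R T N := ⟨fun r t x => mul_smul (φ r) t x⟩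
  exact Module.Finite.trans (R := R) T N

variable {R : Type u} [CommRing R] [IsNoetherianRing R] [IsLocalRing R]

/-- Vanishing of `H^1` would lift the torsion element `1 ∈ R/𝔪` to a torsion element of `R/P`; but
that domain has no nonzero `𝔪`-torsion when `P ≠ 𝔪`. -/
theorem isMaximal_of_isPrime_of_vanishes
    (h : ∀ (N : ModuleCat.{u} R) [Module.Finite R N], LocalCohomologyVanishes (maximalIdeal R) 1 N)
    (P : Ideal R) [hP : P.IsPrime] : P = maximalIdeal R := by
  by_contra hne
  have hle : P ≤ maximalIdeal R := le_maximalIdeal hP.ne_top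
  obtain ⟨y, hy, hyP⟩ := SetLike.exists_of_lt (lt_of_le_of_ne hle hne)
  have hsurj : Function.Surjective (Submodule.factor hle) := Submodule.factor_surjective hle
  have : Module.Finite R (Submodule.factor hle).shortComplexKer.X₁ :=
    inferInstanceAs (Module.Finite R (LinearMap.ker (Submodule.factor hle)))
  obtain ⟨x, ⟨t, ht⟩, hx⟩ := LocalCohomologyVanishes.exists_torsion_lift
    (LinearMap.shortExact_shortComplexKer hsurj) (h _) (Submodule.Quotient.mk (1 : R))
    ⟨1, fun r hr => by
      rw [pow_one] at hr
      rw [← Submodule.Quotient.mk_smul]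
      exact (Submodule.Quotient.mk_eq_zero _).2 (by simpa using hr)⟩
  obtain ⟨x, rfl⟩ := P.mkQ_surjective x
  have h1 : y ^ t * x ∈ P := (Submodule.Quotient.mk_eq_zero P).1 (ht _ (Ideal.pow_mem_pow hy t))
  have h2 : x ∈ P := (hP.mem_or_mem h1).resolve_left fun h => hyP (hP.mem_of_pow_mem _ h)
  have h3 : x - 1 ∈ maximalIdeal R := (Submodule.Quotient.eq (maximalIdeal R)).1 hx
  exact (Ideal.ne_top_iff_one _).1 (maximalIdeal.isMaximal R).ne_top
    (by simpa using Ideal.sub_mem _ (hle h2) h3)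

/-- The degree is positive, so `H(R/𝔪) = 0` and `H(𝔪) → H(R)` is onto. Top-degree right exactness
makes `H(R^n) → H(𝔪)` onto for generators `v_j`; the composite is `∑ v_j` times the projections. -/
theorem maximalIdeal_smul_extColimit {c : ℕ}
    (h : ∀ (N : ModuleCat.{u} R) [Module.Finite R N],
      LocalCohomologyVanishes (maximalIdeal R) (c + 1 + 1) N) :
    maximalIdeal R • (⊤ : Submodule R (ExtColimit (maximalIdeal R) (c + 1) (ModuleCat.of R R))) =
      ⊤ := by
  refine eq_top_iff.2 fun z _ => ?_
  obtain ⟨n, v, hv⟩ := Submodule.fg_iff_exists_fin_generating_family.1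
    (IsNoetherian.noetherian (maximalIdeal R))
  let f : (Fin n → R) →ₗ[R] R := Fintype.linearCombination R v
  have hf : LinearMap.range f = maximalIdeal R := by
    rw [← hv]; exact Fintype.range_linearCombination R v
  let π : R →ₗ[R] R ⧸ maximalIdeal R := (maximalIdeal R).mkQ
  have hπ : LinearMap.ker π = maximalIdeal R := Submodule.ker_mkQ _
  let g : (Fin n → R) →ₗ[R] LinearMap.ker π :=
    LinearMap.codRestrict _ f fun c => by rw [hπ, ← hf]; exact LinearMap.mem_range_self f c
  have hg : Function.Surjective g := by
    rintro ⟨y, hy⟩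
    rw [hπ, ← hf] at hy
    obtain ⟨c, rfl⟩ := hy
    exact ⟨c, rfl⟩
  have hSπ := LinearMap.shortExact_shortComplexKer (f := π) (Submodule.mkQ_surjective _)
  have hSg := LinearMap.shortExact_shortComplexKer hg
  have hk : LocalCohomologyVanishes (maximalIdeal R) (c + 1) π.shortComplexKer.X₃ := by
    refine LocalCohomologyVanishes.of_gammaTorsion_eq_top _ _ _ (eq_top_iff.2 fun y _ => ⟨1, ?_⟩)
    obtain ⟨y, rfl⟩ := Submodule.mkQ_surjective _ y
    intro r hr
    rw [pow_one] at hr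
    rw [← map_smul]
    exact (Submodule.Quotient.mk_eq_zero _).2 (Ideal.mul_mem_right _ _ hr)
  have := ExtColimit.subsingleton_iff.2 hk
  obtain ⟨w, hw⟩ := ExtColimit.exact₂ hSπ z (Subsingleton.elim _ _)
  have : Module.Finite R g.shortComplexKer.X₁ := inferInstanceAs (Module.Finite R (LinearMap.ker g))
  obtain ⟨y, hy⟩ := ExtColimit.map_surjective hSg (h _) w
  have hsum : g.shortComplexKer.g ≫ π.shortComplexKer.f =
      ∑ j, v j • (ModuleCat.ofHom (LinearMap.proj j) :
        ModuleCat.of R (Fin n → R) ⟶ ModuleCat.of R R) := by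
    apply ModuleCat.hom_ext
    apply LinearMap.ext
    intro c
    rw [ModuleCat.hom_sum, LinearMap.sum_apply]
    change f c = ∑ j, v j * c j
    simp [f, Fintype.linearCombination_apply, mul_comm]
  have hz : z = ∑ j, v j • ExtColimit.map (maximalIdeal R) (c + 1)
      (ModuleCat.ofHom (LinearMap.proj j) : ModuleCat.of R (Fin n → R) ⟶ ModuleCat.of R R) y := by
    rw [← hw, ← hy, ← ExtColimit.map_comp]
    refine (congrArg (fun F => ExtColimit.map (maximalIdeal R) (c + 1) F y) hsum).trans ?_
    rw [ExtColimit.map_sum_hom]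
    exact Finset.sum_congr rfl fun j _ => ExtColimit.map_smul_hom _ _ _
  rw [hz]
  refine Submodule.sum_mem _ fun j _ => Submodule.smul_mem_smul ?_ trivial
  rw [← hv]
  exact Submodule.subset_span ⟨j, rfl⟩

theorem exists_mem_maximalIdeal_vanishes_quotient {c : ℕ}
    (h : ∀ (N : ModuleCat.{u} R) [Module.Finite R N],
      LocalCohomologyVanishes (maximalIdeal R) (c + 1 + 1) N) :
    ∃ x ∈ maximalIdeal R, ∀ (N : ModuleCat.{u} (R ⧸ Ideal.span {x}))
      [Module.Finite (R ⧸ Ideal.span {x}) N],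
        LocalCohomologyVanishes ((maximalIdeal R).map (Ideal.Quotient.mk (Ideal.span {x}))) (c + 1)
          N := by
  have : Module.Finite R (ModuleCat.of R R) := inferInstanceAs (Module.Finite R R)
  have := isArtinian_extColimit (c + 1) (ModuleCat.of R R)
  obtain ⟨x, hx, hxs⟩ := exists_mem_maximalIdeal_smul_surjective (maximalIdeal_smul_extColimit h)
  refine ⟨x, hx, ?_⟩
  have h1 := vanishes_quotient_of_smul_surjective h hxs
  set φ := Ideal.Quotient.mk (Ideal.span {x}) with hφ
  have hs : Function.Surjective φ := Ideal.Quotient.mk_surjective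
  apply LocalCohomologyVanishes.of_finite
  · exact (localCohomologyVanishes_restrictScalars_iff_of_surjective φ hs _ _ _).1 h1
  · intro K _
    refine (localCohomologyVanishes_restrictScalars_iff_of_surjective φ hs _ _ _).1 ?_
    have := finite_restrictScalars_of_surjective φ hs K
    exact h _

end NonVanishing

/-! ### Dimension is at most the cohomological dimension of the maximal ideal -/

section KrullDimension

open IsLocalRing

/-- The cohomological dimension of the maximal ideal of a Noetherian local ring is at least the
dimension of the ring. -/
theorem ringKrullDim_le_of_vanishes (c : ℕ) :
    ∀ (R : Type u) [CommRing R] [IsNoetherianRing R] [IsLocalRing R],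
      (∀ (N : ModuleCat.{u} R) [Module.Finite R N] (i : ℕ), c < i →
        LocalCohomologyVanishes (maximalIdeal R) i N) → ringKrullDim R ≤ c := by
  induction c with
  | zero =>
    intro R _ _ _ h
    have : Ring.KrullDimLE 0 R := Ring.krullDimLE_zero_iff.2 fun P hP => by
      rw [isMaximal_of_isPrime_of_vanishes (fun N _ => h N 1 one_pos) P]
      infer_instance
    exact (Ring.krullDimLE_iff).1 this
  | succ c ih =>
    intro R _ _ _ h
    obtain ⟨x, hx, hN⟩ := exists_mem_maximalIdeal_vanishes_quotient
      (fun N _ => h N (c + 1 + 1) (Nat.lt_succ_self _))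
    have : Nontrivial (R ⧸ Ideal.span {x}) := Ideal.Quotient.nontrivial_iff.2 fun htop =>
      (maximalIdeal.isMaximal R).ne_top
        (top_le_iff.1 (htop ▸ (Ideal.span_singleton_le_iff_mem _).2 hx))
    have : IsLocalRing (R ⧸ Ideal.span {x}) :=
      IsLocalRing.of_surjective' (Ideal.Quotient.mk _) Ideal.Quotient.mk_surjective
    -- Degree `c + 1` is the gain from the choice of `x`; higher degrees descend from `R`.
    have hdim := ih (R ⧸ Ideal.span {x}) fun N _ i hi => by
      rw [← maximalIdeal_quotient]
      obtain rfl | hi : i = c + 1 ∨ c + 1 < i := by omega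
      · exact hN N
      · obtain ⟨j, rfl⟩ : ∃ j, i = j + 1 := ⟨i - 1, by omega⟩
        refine (localCohomologyVanishes_restrictScalars_iff_of_surjective
          (Ideal.Quotient.mk (Ideal.span {x})) Ideal.Quotient.mk_surjective _ _ _).1 ?_
        have := finite_restrictScalars_of_surjective _ Ideal.Quotient.mk_surjective N
        exact h _ _ hi
    rw [← maximalIdeal_height_eq_ringKrullDim]
    refine (Ideal.height_le_ringKrullDim_quotient_add_one hx).trans ?_
    push_cast
    gcongr

end KrullDimension

/-! ### Height is at most the cohomological dimension -/

section HeightBound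

open IsLocalRing

/-- The height of a proper ideal is a lower bound for its cohomological dimension. -/
theorem Ideal.height_le_of_vanishes {R : Type u} [CommRing R] [IsNoetherianRing R] {a : Ideal R}
    (ha : a ≠ ⊤) {c : ℕ}
    (h : ∀ (M : ModuleCat.{u} R) (i : ℕ), c < i → LocalCohomologyVanishes a i M) :
    a.height ≤ c := by
  -- Localised at a minimal prime `p`, the ideal has the maximal ideal as radical, so flat base
  -- change and cofinality transfer the vanishing to it; finally `ht a ≤ ht p = dim T`.
  obtain ⟨p, hp⟩ := Ideal.nonempty_minimalPrimes ha
  have : p.IsPrime := hp.1.1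
  let T := Localization.AtPrime p
  have : IsNoetherianRing T := IsLocalization.isNoetherianRing p.primeCompl T inferInstance
  have hφ : (algebraMap R T).Flat :=
    RingHom.flat_algebraMap_iff.2 (IsLocalization.flat T p.primeCompl)
  have hrad : (a.map (algebraMap R T)).radical = maximalIdeal T :=
    (IsLocalization.AtPrime.radical_map_of_mem_minimalPrimes T p a hp).trans
      (IsLocalization.AtPrime.map_eq_maximalIdeal p T)
  obtain ⟨s, hs⟩ := Ideal.exists_pow_le_of_le_radical_of_fg hrad.ge
    (IsNoetherian.noetherian (maximalIdeal T))
  have hdim : ringKrullDim T ≤ c := by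
    refine ringKrullDim_le_of_vanishes c T fun N _ i hi => ?_
    obtain ⟨j, rfl⟩ : ∃ j, i = j + 1 := ⟨i - 1, by omega⟩
    refine LocalCohomologyVanishes.of_cofinal
      ((localCohomologyVanishes_restrictScalars_iff_of_flat _ hφ _ _ _).1 (h _ _ hi))
      (fun t => ⟨t, Ideal.pow_right_mono (hrad ▸ Ideal.le_radical) t⟩) (fun t => ⟨s * t, ?_⟩)
    rw [pow_mul]
    exact Ideal.pow_right_mono hs t
  rw [IsLocalization.AtPrime.ringKrullDim_eq_height p T] at hdim
  exact (Ideal.height_mono hp.1.2).trans (WithBot.coe_le_coe.1 hdim)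

theorem localCohomologyVanishes_minorsIdeal_min {R : Type u} [CommRing R] [IsNoetherianRing R]
    {q : ℕ} [CharP R q] (hq : 0 < q) {m n : ℕ} (A : Matrix (Fin m) (Fin n) R) {i : ℕ}
    (hi : ((n : ℤ) - (m : ℤ)).natAbs + 1 < i) (M : ModuleCat.{u} R) :
    LocalCohomologyVanishes (A.minorsIdeal (min m n)) i M := by
  have hM : ∀ x : M, (q : R) • x = 0 := fun x => by rw [CharP.cast_eq_zero, zero_smul]
  rcases le_total m n with h | h
  · rw [min_eq_left h]
    exact localCohomologyVanishes_minorsIdeal h A (by omega) q hq M hM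
  · rw [min_eq_right h, ← Matrix.minorsIdeal_transpose]
    exact localCohomologyVanishes_minorsIdeal h A.transpose (by omega) q hq M hM

end HeightBound

end

theorem corollary2p4 {R : Type u} [CommRing R] [IsNoetherianRing R]
    (q : ℕ) [CharP R q] (hq : 0 < q)
    (m n : ℕ) (A : Matrix (Fin m) (Fin n) R)
    (hht : (A.minorsIdeal (min m n)).height = ((((n : ℤ) - (m : ℤ)).natAbs + 1 : ℕ) : ℕ∞)) :
    (A.minorsIdeal (min m n)).cohomologicalDimension = (A.minorsIdeal (min m n)).height := by
  -- The unit ideal has height `⊤`, so finiteness of the height forces properness.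
  have ha : A.minorsIdeal (min m n) ≠ ⊤ := by
    intro h
    rw [h, Ideal.height_top] at hht
    exact ENat.natCast_ne_top _ hht.symm
  refine le_antisymm ?_ (le_iInf₂ fun c hc => ?_)
  · rw [hht]
    refine iInf₂_le _ fun M i hi => ?_
    obtain ⟨j, rfl⟩ : ∃ j, i = j + 1 := ⟨i - 1, by omega⟩
    exact (isZero_localCohomology_iff _ j M).2 (localCohomologyVanishes_minorsIdeal_min hq A hi M)
  · refine Ideal.height_le_of_vanishes ha fun M i hi => ?_
    obtain ⟨j, rfl⟩ : ∃ j, i = j + 1 := ⟨i - 1, by omega⟩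
    exact (isZero_localCohomology_iff _ j M).1 (hc M (j + 1) hi)
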